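/- Let $I=(0,1)$ and $\phi_1(x)=\sqrt2\sin(\pi x)$. For $\kappa\in\mathbb R$ consider in $L^2(I;\mathbb R)$ the operator $$A_\kappa g=-\partial_{xx}g-\pi^2g+2\kappa\phi_1^2g,\qquad \mathbb D(A_\kappa)=H^2\cap H^1_0(I;\mathbb R).$$ For every $\kappa\in\mathbb R$ the eigenvalues of $A_\kappa$ form an infinite strictly increasing sequence $\lambda_{1,\kappa}<\lambda_{2,\kappa}<\dots$ (indexed by the integers $k\ge1$ and exhausting all eigenvalues). For every $k\ge1$ the function $\kappa\mapsto\lambda_{k,\kappa}$ is real-analytic and strictly increasing on $\mathbb R$. Moreover, there is an at most countable set $\mathbb K\subset(-\infty,0]$ such that, for any $\kappa\in\mathbb R\setminus\mathbb K$ and any $k\ge1$, we have $\lambda_{k,\kappa}\neq0$. -/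

import Mathlib

open Set MeasureTheory

noncomputable section

/-- The real Hilbert space `L²(I; ℝ)`, `I = (0, 1)`, with Lebesgue measure. -/
abbrev L2I : Type := Lp ℝ 2 (volume.restrict (Ioo (0 : ℝ) 1))

/-- Test functions on `I = (0, 1)`: smooth functions with compact support contained in `I`. -/
def IsTestFun (φ : ℝ → ℝ) : Prop :=
  ContDiff ℝ (⊤ : ℕ∞) φ ∧ HasCompactSupport φ ∧ tsupport φ ⊆ Ioo (0 : ℝ) 1

/-- `h ∈ L²(I)` is the weak derivative of `g ∈ L²(I)` on `I`. -/
def IsWeakDeriv (g h : L2I) : Prop :=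
  ∀ φ : ℝ → ℝ, IsTestFun φ →
    ∫ x in Ioo (0 : ℝ) 1, g x * deriv φ x = - ∫ x in Ioo (0 : ℝ) 1, h x * φ x

theorem L2I.integrable_mul (g : L2I) {ψ : ℝ → ℝ} (hc : Continuous ψ)
    (hs : HasCompactSupport ψ) :
    Integrable (fun x => g x * ψ x) (volume.restrict (Ioo (0 : ℝ) 1)) := by
  obtain ⟨C, hC⟩ := hs.exists_bound_of_continuous hc
  have hg : Integrable (fun x => g x) (volume.restrict (Ioo (0 : ℝ) 1)) :=
    (Lp.memLp g).integrable (by norm_num)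
  exact hg.mul_bdd (c := C) hc.aestronglyMeasurable (.of_forall hC)

theorem IsTestFun.integrable_mul {φ : ℝ → ℝ} (hφ : IsTestFun φ) (g : L2I) :
    Integrable (fun x => g x * φ x) (volume.restrict (Ioo (0 : ℝ) 1)) :=
  g.integrable_mul hφ.1.continuous hφ.2.1

theorem IsTestFun.integrable_mul_deriv {φ : ℝ → ℝ} (hφ : IsTestFun φ) (g : L2I) :
    Integrable (fun x => g x * deriv φ x) (volume.restrict (Ioo (0 : ℝ) 1)) :=
  g.integrable_mul (hφ.1.continuous_deriv (by simp)) hφ.2.1.deriv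

theorem L2I.integral_add_mul (g g' : L2I) {ψ : ℝ → ℝ}
    (h : Integrable (fun x => g x * ψ x) (volume.restrict (Ioo (0 : ℝ) 1)))
    (h' : Integrable (fun x => g' x * ψ x) (volume.restrict (Ioo (0 : ℝ) 1))) :
    ∫ x in Ioo (0 : ℝ) 1, (g + g' : L2I) x * ψ x =
      (∫ x in Ioo (0 : ℝ) 1, g x * ψ x) + ∫ x in Ioo (0 : ℝ) 1, g' x * ψ x := by
  rw [← integral_add h h']
  refine integral_congr_ae ?_
  filter_upwards [Lp.coeFn_add g g'] with x hx
  rw [hx, Pi.add_apply, add_mul]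

theorem L2I.integral_smul_mul (c : ℝ) (g : L2I) (ψ : ℝ → ℝ) :
    ∫ x in Ioo (0 : ℝ) 1, (c • g : L2I) x * ψ x = c * ∫ x in Ioo (0 : ℝ) 1, g x * ψ x := by
  rw [← integral_const_mul]
  refine integral_congr_ae ?_
  filter_upwards [Lp.coeFn_smul c g] with x hx
  rw [hx, Pi.smul_apply, smul_eq_mul, mul_assoc]

theorem IsWeakDeriv.add {g h g' h' : L2I} (H : IsWeakDeriv g h) (H' : IsWeakDeriv g' h') :
    IsWeakDeriv (g + g') (h + h') := by
  intro φ hφ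
  rw [L2I.integral_add_mul _ _ (hφ.integrable_mul_deriv g) (hφ.integrable_mul_deriv g'),
    L2I.integral_add_mul _ _ (hφ.integrable_mul h) (hφ.integrable_mul h'), H φ hφ, H' φ hφ]
  ring

theorem IsWeakDeriv.smul (c : ℝ) {g h : L2I} (H : IsWeakDeriv g h) :
    IsWeakDeriv (c • g) (c • h) := by
  intro φ hφ
  rw [L2I.integral_smul_mul, L2I.integral_smul_mul, H φ hφ]
  ring

theorem IsWeakDeriv.zero : IsWeakDeriv 0 0 := by
  intro φ _
  have h0 : ∀ ψ : ℝ → ℝ, ∫ x in Ioo (0 : ℝ) 1, (0 : L2I) x * ψ x = 0 := fun ψ => by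
    simpa using L2I.integral_smul_mul 0 0 ψ
  rw [h0, h0, neg_zero]

theorem IsWeakDeriv.unique {g h h' : L2I} (H : IsWeakDeriv g h) (H' : IsWeakDeriv g h') :
    h = h' := by
  have H0 := H.add (H'.smul (-1))
  have hz : ∀ φ, IsTestFun φ →
      ∫ x in Ioo (0 : ℝ) 1, (h + (-1 : ℝ) • h' : L2I) x * φ x = 0 := by
    intro φ hφ
    have h1 := H φ hφ
    have h2 := H' φ hφ
    rw [L2I.integral_add_mul _ _ (hφ.integrable_mul _) (hφ.integrable_mul _),
      L2I.integral_smul_mul]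
    linarith
  have hint : IntegrableOn (fun x => (h + (-1 : ℝ) • h' : L2I) x) (Ioo (0 : ℝ) 1) volume :=
    (Lp.memLp (h + (-1 : ℝ) • h' : L2I)).integrable (by norm_num)
  have key := isOpen_Ioo.ae_eq_zero_of_integral_contDiff_smul_eq_zero
    (μ := volume) hint.locallyIntegrableOn (by
      intro φ h1 h2 h3
      have := hz φ ⟨h1, h2, h3⟩
      rw [setIntegral_eq_integral_of_forall_compl_eq_zero] at this
      · simpa [mul_comm] using this
      · intro x hx
        have : φ x = 0 := image_eq_zero_of_notMem_tsupport (fun hh => hx (h3 hh))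
        simp [this])
  have hzero : (h + (-1 : ℝ) • h' : L2I) = 0 := by
    rw [Lp.eq_zero_iff_ae_eq_zero]
    rw [Filter.EventuallyEq, ae_restrict_iff' measurableSet_Ioo]
    exact key
  have : h - h' = 0 := by simpa [sub_eq_add_neg] using hzero
  exact sub_eq_zero.mp this

theorem IsWeakDeriv.unique₂ {g h k h' k' : L2I} (H1 : IsWeakDeriv g h) (H2 : IsWeakDeriv h k)
    (H1' : IsWeakDeriv g h') (H2' : IsWeakDeriv h' k') : k = k' := by
  obtain rfl := H1.unique H1'
  exact H2.unique H2'

/-- The Sobolev space `H²(I; ℝ)`: functions in `L²` whose first two weak derivatives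
are in `L²`. -/
def H2I : Submodule ℝ L2I where
  carrier := {g | ∃ h k : L2I, IsWeakDeriv g h ∧ IsWeakDeriv h k}
  add_mem' := by
    rintro _ _ ⟨h, k, h1, h2⟩ ⟨h', k', h1', h2'⟩
    exact ⟨h + h', k + k', h1.add h1', h2.add h2'⟩
  zero_mem' := ⟨0, 0, IsWeakDeriv.zero, IsWeakDeriv.zero⟩
  smul_mem' := by
    rintro c _ ⟨h, k, h1, h2⟩
    exact ⟨c • h, c • k, h1.smul c, h2.smul c⟩

/-- The Sobolev space `H¹₀(I; ℝ)`: the closure of the test functions in `H¹`, that is, all `g`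
such that `(g, g')` is a limit in `L² × L²` of pairs `(φ, φ')` with `φ` a test function. (Test
functions form a vector space, so the linear span below adds nothing; it only makes the closure
a submodule by construction.) -/
def H10I : Submodule ℝ L2I :=
  (Submodule.span ℝ {p : L2I × L2I | ∃ φ : ℝ → ℝ, IsTestFun φ ∧
      p.1 =ᵐ[volume.restrict (Ioo (0 : ℝ) 1)] φ ∧
      p.2 =ᵐ[volume.restrict (Ioo (0 : ℝ) 1)] deriv φ}).topologicalClosure.map
    (LinearMap.fst ℝ L2I L2I)

/-- The weak second derivative `g ↦ ∂ₓₓ g` on `H²(I; ℝ)`. -/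
def secondDeriv : H2I →ₗ[ℝ] L2I where
  toFun g := g.2.choose_spec.choose
  map_add' g g' := by
    have h := g.2.choose_spec.choose_spec
    have h' := g'.2.choose_spec.choose_spec
    have h0 := (g + g').2.choose_spec.choose_spec
    exact h0.1.unique₂ h0.2 (h.1.add h'.1) (h.2.add h'.2)
  map_smul' c g := by
    have h := g.2.choose_spec.choose_spec
    have h0 := (c • g).2.choose_spec.choose_spec
    exact h0.1.unique₂ h0.2 (h.1.smul c) (h.2.smul c)

theorem secondDeriv_eq (g : H2I) {h k : L2I} (h1 : IsWeakDeriv g h) (h2 : IsWeakDeriv h k) :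
    secondDeriv g = k := by
  have h0 := g.2.choose_spec.choose_spec
  exact h0.1.unique₂ h0.2 h1 h2

/-- `φ₁(x) = √2 sin(π x)`. -/
def phi1 (x : ℝ) : ℝ := √2 * Real.sin (Real.pi * x)

theorem memLp_phi1_sq_mul (g : L2I) :
    MemLp (fun x => phi1 x ^ 2 * g x) 2 (volume.restrict (Ioo (0 : ℝ) 1)) := by
  refine MemLp.of_le_mul (c := 2) (Lp.memLp g) ?_ (.of_forall fun x => ?_)
  · have : Continuous fun x => phi1 x ^ 2 := by unfold phi1; fun_prop
    exact this.aestronglyMeasurable.mul (Lp.memLp g).1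
  · have h1 : phi1 x ^ 2 ≤ 2 := by
      have := Real.sin_sq_le_one (Real.pi * x)
      rw [phi1, mul_pow, Real.sq_sqrt (by norm_num)]
      linarith
    rw [norm_mul, Real.norm_of_nonneg (sq_nonneg _)]
    gcongr

/-- Multiplication by `φ₁²` on `L²(I; ℝ)`. -/
def mulPhi1Sq : L2I →ₗ[ℝ] L2I where
  toFun g := (memLp_phi1_sq_mul g).toLp _
  map_add' g g' := by
    rw [← MemLp.toLp_add, MemLp.toLp_eq_toLp_iff]
    filter_upwards [Lp.coeFn_add g g'] with x hx
    rw [hx]; simp only [Pi.add_apply]; ring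
  map_smul' c g := by
    rw [RingHom.id_apply, ← MemLp.toLp_const_smul, MemLp.toLp_eq_toLp_iff]
    filter_upwards [Lp.coeFn_smul c g] with x hx
    rw [hx]; simp only [Pi.smul_apply, smul_eq_mul]; ring

/-- The unbounded operator `A_κ g = -∂ₓₓ g - π² g + 2 κ φ₁² g` on `L²(I; ℝ)` with domain
`H² ∩ H¹₀(I; ℝ)`. -/
def opA (κ : ℝ) : L2I →ₗ.[ℝ] L2I where
  domain := H2I ⊓ H10I
  toFun :=
    -(secondDeriv ∘ₗ Submodule.inclusion inf_le_left)
      - (Real.pi ^ 2) • (H2I ⊓ H10I).subtype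
      + (2 * κ) • (mulPhi1Sq ∘ₗ (H2I ⊓ H10I).subtype)

/-- `μ` is an eigenvalue of the (unbounded) operator `T` on `L²(I; ℝ)`. -/
def IsEigenvalue (T : L2I →ₗ.[ℝ] L2I) (μ : ℝ) : Prop :=
  ∃ g : T.domain, (g : L2I) ≠ 0 ∧ T g = μ • (g : L2I)

end

/-! The eigenvalue equation reads y'' = q y with q = 2κφ₁² − π² − μ. By shooting, μ is an eigenvalue
exactly when the solution with y(0) = 0, y'(0) = 1 satisfies y(1) = 0 (`isEigenvalue_iff`). The
Prüfer angle θ, a continuous argument of y' + iy, solves θ' = 1 − (1 + q) sin²θ, and y(1) = 0 means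
θ(1) ∈ πℤ. Comparison (`angle_comparison`) makes θ(1) strictly increasing in μ and strictly
decreasing in κ. Constant potentials show that every kπ with k ≥ 1 is attained, and `angle_pos`
excludes the other multiples. So λ_{k,κ} is the unique μ with θ(1) = kπ, which gives the
enumeration, the order in k and the monotonicity in κ.

For analyticity, y is obtained by applying (1 − T_q)⁻¹ to the function x, where T_q is a
quasi-nilpotent Volterra operator linear in q; so y(1) is analytic in (κ, μ). Lagrange's identity
shows that its zeros in μ are simple, and the implicit function theorem gives an analytic branch,
which is λ_k because λ_k is continuous.

The weak formulation is handled by duality, without regularity theory: if y(1) ≠ 0, then v'' = q v +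
f, v(0) = v(1) = 0 is solvable for every continuous f, and testing with v shows that a weak solution
is orthogonal to f.

At κ = 0 all eigenvalues are nonnegative, so each strictly increasing λ_k vanishes at most once, at
some κ ≤ 0; these points form the exceptional set. -/

noncomputable section

/-! ### Integration on the Banach algebra C[0, 1]. -/

/-- Continuous real functions on `[0, 1]`, with the sup norm. -/
def CI : Type := C(Icc (0 : ℝ) 1, ℝ)

namespace CI

instance : NormedCommRing CI := inferInstanceAs (NormedCommRing C(Icc (0 : ℝ) 1, ℝ))
instance : NormedAlgebra ℝ CI := inferInstanceAs (NormedAlgebra ℝ C(Icc (0 : ℝ) 1, ℝ))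
instance : CompleteSpace CI := inferInstanceAs (CompleteSpace C(Icc (0 : ℝ) 1, ℝ))
instance : FunLike CI (Icc (0 : ℝ) 1) ℝ := inferInstanceAs (FunLike C(Icc (0 : ℝ) 1, ℝ) _ _)

theorem continuous_coe (f : CI) : Continuous f := ContinuousMap.continuous (X := Icc (0 : ℝ) 1) f

theorem norm_coe_le_norm (f : CI) (x : Icc (0 : ℝ) 1) : ‖f x‖ ≤ ‖f‖ :=
  ContinuousMap.norm_coe_le_norm (α := Icc (0 : ℝ) 1) f x

theorem norm_le {f : CI} {C : ℝ} (hC : 0 ≤ C) : ‖f‖ ≤ C ↔ ∀ x, ‖f x‖ ≤ C :=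
  ContinuousMap.norm_le (α := Icc (0 : ℝ) 1) f hC

@[ext] theorem ext_coe {f g : CI} (h : ∀ x, f x = g x) : f = g :=
  ContinuousMap.ext (X := Icc (0 : ℝ) 1) h

/-- Evaluation at a point. -/
def eval (x : Icc (0 : ℝ) 1) : CI →L[ℝ] ℝ :=
  LinearMap.mkContinuous
    { toFun := fun f => f x
      map_add' := fun _ _ => rfl
      map_smul' := fun _ _ => rfl } 1 fun f => by rw [one_mul]; exact f.norm_coe_le_norm x

/-- The extension of `f ∈ C[0, 1]` to the line, constant on both sides of `[0, 1]`. -/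
def ext (f : CI) (x : ℝ) : ℝ := IccExtend zero_le_one f x

theorem continuous_ext (f : CI) : Continuous f.ext := f.continuous_coe.Icc_extend'

theorem ext_of_mem (f : CI) {x : ℝ} (hx : x ∈ Icc (0 : ℝ) 1) : f.ext x = f ⟨x, hx⟩ :=
  IccExtend_of_mem _ _ hx

theorem abs_ext_le (f : CI) (x : ℝ) : |f.ext x| ≤ ‖f‖ := f.norm_coe_le_norm _

@[simp] theorem ext_add (f g : CI) (x : ℝ) : (f + g).ext x = f.ext x + g.ext x := rfl
@[simp] theorem ext_sub (f g : CI) (x : ℝ) : (f - g).ext x = f.ext x - g.ext x := rfl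
@[simp] theorem ext_mul (f g : CI) (x : ℝ) : (f * g).ext x = f.ext x * g.ext x := rfl
@[simp] theorem ext_smul (c : ℝ) (f : CI) (x : ℝ) : (c • f).ext x = c * f.ext x := rfl
@[simp] theorem ext_one (x : ℝ) : (1 : CI).ext x = 1 := rfl

/-- The restriction to `[0, 1]` of a continuous function on the line. -/
def ofCont (f : ℝ → ℝ) (hf : Continuous f) : CI := 
  (⟨fun x => f x, by fun_prop⟩ : C(Icc (0 : ℝ) 1, ℝ))

theorem ext_ofCont (f : ℝ → ℝ) (hf : Continuous f) {x : ℝ} (hx : x ∈ Icc (0 : ℝ) 1) :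
    (ofCont f hf).ext x = f x := by
  rw [ext_of_mem _ hx]; rfl

/-- The primitive vanishing at `0` of the extension of `f`. -/
def prim (f : CI) (x : ℝ) : ℝ := ∫ t in (0 : ℝ)..x, f.ext t

/-- Extending f beyond [0, 1] makes this a two-sided derivative at the endpoints too, so one-sided
derivatives never occur. -/
theorem hasDerivAt_prim (f : CI) (x : ℝ) : HasDerivAt f.prim (f.ext x) x :=
  (f.continuous_ext.integral_hasStrictDerivAt 0 x).hasDerivAt

theorem continuous_prim (f : CI) : Continuous f.prim :=
  continuous_iff_continuousAt.2 fun x => (f.hasDerivAt_prim x).continuousAt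

@[simp] theorem prim_zero_right (f : CI) : f.prim 0 = 0 := by simp [prim]

/-- The factorial gain of one integration; iterated, it makes Volterra operators quasi-nilpotent. -/
theorem abs_prim_le {f : CI} {C : ℝ} {n : ℕ}
    (h : ∀ t ∈ Icc (0 : ℝ) 1, |f.ext t| ≤ C * (t ^ n / n.factorial)) {x : ℝ}
    (hx : x ∈ Icc (0 : ℝ) 1) : |f.prim x| ≤ C * (x ^ (n + 1) / (n + 1).factorial) := by
  have h1 : ‖∫ t in (0 : ℝ)..x, f.ext t‖ ≤ ∫ t in (0 : ℝ)..x, C * (t ^ n / n.factorial) := by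
    refine intervalIntegral.norm_integral_le_of_norm_le hx.1 ?_ ?_
    · exact .of_forall fun t ht => h t ⟨ht.1.le, ht.2.trans hx.2⟩
    · exact Continuous.intervalIntegrable (by fun_prop) _ _
  refine h1.trans (le_of_eq ?_)
  rw [intervalIntegral.integral_const_mul, intervalIntegral.integral_div, integral_pow]
  have : (n.factorial : ℝ) ≠ 0 := by positivity
  push_cast [Nat.factorial_succ]
  field_simp
  simp

/-- The Volterra operator `f ↦ ∫₀ˣ f` on `C[0, 1]`. -/
def volterra : CI →L[ℝ] CI :=
  LinearMap.mkContinuous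
    { toFun := fun f => ofCont f.prim f.continuous_prim
      map_add' := fun f g => by
        ext x
        exact intervalIntegral.integral_add (f.continuous_ext.intervalIntegrable _ _)
          (g.continuous_ext.intervalIntegrable _ _)
      map_smul' := fun c f => by
        ext x
        exact intervalIntegral.integral_const_mul c _ } 1 (fun f => by
    rw [one_mul, norm_le (norm_nonneg _)]
    intro x
    have := abs_prim_le (f := f) (C := ‖f‖) (n := 0) (fun t _ => by simpa using f.abs_ext_le t) x.2
    refine this.trans ?_
    simpa using mul_le_of_le_one_right (norm_nonneg f) x.2.2)

theorem ext_volterra (f : CI) {x : ℝ} (hx : x ∈ Icc (0 : ℝ) 1) :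
    (volterra f).ext x = f.prim x := ext_ofCont _ f.continuous_prim hx

theorem eval_volterra_one (f : CI) : eval ⟨1, by simp⟩ (volterra f) = f.prim 1 := rfl

/-! ### The initial value problem y'' = q y and its analytic dependence on q. -/

/-- The operator `f ↦ ∫₀ˣ ∫₀ˢ q f` on `C[0, 1]`, as a continuous linear function of `q`. -/
def potentialOp : CI →L[ℝ] CI →L[ℝ] CI :=
  (ContinuousLinearMap.compL ℝ CI CI CI (volterra.comp volterra)).comp
    (ContinuousLinearMap.mul ℝ CI)

theorem potentialOp_apply (q f : CI) : potentialOp q f = volterra (volterra (q * f)) := rfl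

theorem abs_potentialOp_pow_le (q f : CI) (n : ℕ) : ∀ x ∈ Icc (0 : ℝ) 1,
    |((potentialOp q ^ n) f).ext x| ≤ ‖q‖ ^ n * ‖f‖ * (x ^ (2 * n) / (2 * n).factorial) := by
  induction n with
  | zero => intro x hx; simpa using f.abs_ext_le x
  | succ n ih =>
    intro x hx
    rw [pow_succ', mul_apply_eq_comp, potentialOp_apply, ext_volterra _ hx]
    refine abs_prim_le (n := 2 * n + 1) (fun t ht => ?_) hx
    rw [ext_volterra _ ht]
    refine abs_prim_le (n := 2 * n) (fun s hs => ?_) ht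
    rw [ext_mul, abs_mul, pow_succ', mul_assoc, mul_assoc]
    rw [← mul_assoc (‖q‖ ^ n)]
    exact mul_le_mul (q.abs_ext_le s) (ih s hs) (abs_nonneg _) (norm_nonneg _)

theorem norm_potentialOp_pow_le (q : CI) (n : ℕ) :
    ‖potentialOp q ^ n‖ ≤ ‖q‖ ^ n / n.factorial := by
  refine ContinuousLinearMap.opNorm_le_bound _ (by positivity) fun f => ?_
  rw [norm_le (by positivity)]
  intro x
  have h := abs_potentialOp_pow_le q f n x x.2
  rw [ext_of_mem _ x.2] at h
  refine h.trans ?_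
  have h1 : (x : ℝ) ^ (2 * n) / (2 * n).factorial ≤ 1 / n.factorial := by
    have : (n.factorial : ℝ) ≤ (2 * n).factorial :=
      mod_cast Nat.factorial_le (Nat.le_mul_of_pos_left n two_pos)
    have hx : (x : ℝ) ^ (2 * n) ≤ 1 := pow_le_one₀ x.2.1 x.2.2
    gcongr
  calc _ ≤ ‖q‖ ^ n * ‖f‖ * (1 / n.factorial) := by gcongr
    _ = _ := by ring

/-- Some power Tⁿ has norm below 1, so 1 − Tⁿ is invertible; it is the product of 1 − T and a
commuting geometric sum, hence 1 − T is invertible for q of any size. -/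
theorem isUnit_one_sub_potentialOp (q : CI) : IsUnit (1 - potentialOp q) := by
  obtain ⟨n, hn⟩ := ((FloorSemiring.tendsto_pow_div_factorial_atTop ‖q‖).eventually
    (gt_mem_nhds one_pos)).exists
  have h := isUnit_one_sub_of_norm_lt_one ((norm_potentialOp_pow_le q n).trans_lt hn)
  have hc : Commute (1 - potentialOp q) (∑ i ∈ Finset.range n, potentialOp q ^ i) :=
    (mul_neg_geom_sum _ _).trans (geom_sum_mul_neg _ _).symm
  rw [← mul_neg_geom_sum] at h
  exact (hc.isUnit_mul_iff.1 h).1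

/-- The inverse of `1 - potentialOp q`. -/
def resolvent (q : CI) : CI →L[ℝ] CI := Ring.inverse (1 - potentialOp q)

theorem analyticAt_resolvent (q : CI) : AnalyticAt ℝ resolvent q := by
  have h : AnalyticAt ℝ Ring.inverse (1 - potentialOp q) := by
    simpa using analyticAt_inverse (𝕜 := ℝ) (isUnit_one_sub_potentialOp q).unit
  have h2 : AnalyticAt ℝ (fun q : CI => 1 - potentialOp q) q :=
    analyticAt_const.sub (potentialOp.analyticAt q)
  exact h.fun_comp (f := fun q : CI => 1 - potentialOp q) h2

theorem resolvent_eq (q f : CI) : resolvent q f = f + potentialOp q (resolvent q f) := by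
  have h := Ring.mul_inverse_cancel _ (isUnit_one_sub_potentialOp q)
  have := congrArg (fun T : CI →L[ℝ] CI => T f) h
  simp only [mul_apply_eq_comp, sub_apply, one_apply_eq_self] at this
  exact sub_eq_iff_eq_add.1 this

/-- The solution of `y'' = q y`, `y(0) = 0`, `y'(0) = 1` on `[0, 1]`. -/
def sol (q : CI) : CI := resolvent q (volterra 1)

/-- The derivative of `sol q`. -/
def dsol (q : CI) : CI := 1 + volterra (q * sol q)

theorem sol_eq (q : CI) : sol q = volterra (dsol q) := by
  rw [dsol, map_add]; exact resolvent_eq q _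

theorem analyticAt_sol (q : CI) : AnalyticAt ℝ sol q :=
  (ContinuousLinearMap.apply ℝ CI (volterra 1 : CI)).analyticAt _ |>.fun_comp
    (analyticAt_resolvent q)

theorem continuous_sol : Continuous sol :=
  continuous_iff_continuousAt.2 fun q => (analyticAt_sol q).continuousAt

theorem continuous_dsol : Continuous dsol := by
  have := continuous_sol
  unfold dsol
  fun_prop

/-- `y` solves `y'' = q y` on `[0, 1]` with `y(0) = 0`, `y'(0) = 1`, and `p = y'`. -/
structure IsSol (q : CI) (y p : ℝ → ℝ) : Prop where
  zero : y 0 = 0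
  dzero : p 0 = 1
  deriv : ∀ x ∈ Icc (0 : ℝ) 1, HasDerivAt y (p x) x
  dderiv : ∀ x ∈ Icc (0 : ℝ) 1, HasDerivAt p (q.ext x * y x) x

/-- A primitive of the extension of `dsol q`; on `[0, 1]` it is `sol q`. -/
def solFun (q : CI) : ℝ → ℝ := (dsol q).prim

/-- The extension to the line, by the integral formula, of `dsol q`. -/
def dsolFun (q : CI) (x : ℝ) : ℝ := 1 + (q * sol q).prim x

theorem solFun_eq (q : CI) {x : ℝ} (hx : x ∈ Icc (0 : ℝ) 1) : q.solFun x = q.sol.ext x := by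
  rw [sol_eq, ext_volterra _ hx, solFun]

theorem dsolFun_eq (q : CI) {x : ℝ} (hx : x ∈ Icc (0 : ℝ) 1) : q.dsolFun x = q.dsol.ext x := by
  rw [dsol, ext_add, ext_volterra _ hx, dsolFun, ext_one]

theorem isSol (q : CI) : IsSol q q.solFun q.dsolFun where
  zero := prim_zero_right _
  dzero := by simp [dsolFun]
  deriv x hx := by rw [dsolFun_eq q hx]; exact hasDerivAt_prim _ x
  dderiv x hx := by
    rw [solFun_eq q hx]
    exact ((q * sol q).hasDerivAt_prim x).const_add 1


/-! ### Energy estimates and uniqueness. -/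

theorem monotoneOn_of_hasDerivAt_nonneg {f f' : ℝ → ℝ}
    (h : ∀ x ∈ Icc (0 : ℝ) 1, HasDerivAt f (f' x) x) (h0 : ∀ x ∈ Icc (0 : ℝ) 1, 0 ≤ f' x) :
    MonotoneOn f (Icc 0 1) := by
  refine monotoneOn_of_deriv_nonneg (convex_Icc 0 1)
    (fun x hx => (h x hx).continuousAt.continuousWithinAt) (fun x hx => ?_) (fun x hx => ?_)
  · exact (h x (interior_subset hx)).differentiableAt.differentiableWithinAt
  · rw [(h x (interior_subset hx)).deriv]
    exact h0 x (interior_subset hx)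

/-- Both growth bounds for the energy of a solution of `y'' = q y`. -/
theorem energy_bounds {q : CI} {y p : ℝ → ℝ} (hy : ∀ x ∈ Icc (0 : ℝ) 1, HasDerivAt y (p x) x)
    (hp : ∀ x ∈ Icc (0 : ℝ) 1, HasDerivAt p (q.ext x * y x) x) {x : ℝ} (hx : x ∈ Icc (0 : ℝ) 1) :
    (y 0 ^ 2 + p 0 ^ 2 ≤ (y x ^ 2 + p x ^ 2) * Real.exp ((1 + ‖q‖) * x)) ∧
      (y x ^ 2 + p x ^ 2) * Real.exp (-(1 + ‖q‖) * x) ≤ y 0 ^ 2 + p 0 ^ 2 := by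
  have key : ∀ c : ℝ, ∀ x ∈ Icc (0 : ℝ) 1,
      HasDerivAt (fun x => (y x ^ 2 + p x ^ 2) * Real.exp (c * x))
        ((2 * (1 + q.ext x) * (y x * p x) + c * (y x ^ 2 + p x ^ 2)) * Real.exp (c * x)) x := by
    intro c x hx
    have h1 := ((hy x hx).pow 2).add ((hp x hx).pow 2)
    have h2 := ((hasDerivAt_id x).const_mul c).exp
    refine (h1.mul h2).congr_deriv ?_
    simp only [Pi.add_apply, Pi.pow_apply, id]
    push_cast
    ring
  -- The energy y² + p² has derivative 2(1 + q)yp, so its logarithmic rate is at most 1 + ‖q‖ in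
  -- absolute value.
  have hb : ∀ x, |2 * (1 + q.ext x) * (y x * p x)| ≤ (1 + ‖q‖) * (y x ^ 2 + p x ^ 2) := by
    intro x
    have h1 : |1 + q.ext x| ≤ 1 + ‖q‖ :=
      (abs_add_le _ _).trans (by simpa using q.abs_ext_le x)
    have h2 : |2 * (y x * p x)| ≤ y x ^ 2 + p x ^ 2 := by
      rw [abs_le]
      constructor <;> nlinarith [sq_nonneg (y x + p x), sq_nonneg (y x - p x)]
    rw [show 2 * (1 + q.ext x) * (y x * p x) = (1 + q.ext x) * (2 * (y x * p x)) by ring, abs_mul]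
    exact mul_le_mul h1 h2 (abs_nonneg _) (by positivity)
  have h01 : (0 : ℝ) ∈ Icc (0 : ℝ) 1 := by simp
  constructor
  · have := monotoneOn_of_hasDerivAt_nonneg (key (1 + ‖q‖)) (fun x _ =>
      mul_nonneg (by linarith [abs_le.1 (hb x)]) (Real.exp_pos _).le) h01 hx hx.1
    simpa using this
  · have := monotoneOn_of_hasDerivAt_nonneg (fun x hx => (key (-(1 + ‖q‖)) x hx).neg) (fun x _ => by
      rw [← neg_mul]
      exact mul_nonneg (by linarith [abs_le.1 (hb x)]) (Real.exp_pos _).le) h01 hx hx.1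
    simpa using this

theorem IsSol.energy_pos {q : CI} {y p : ℝ → ℝ} (h : IsSol q y p) {x : ℝ}
    (hx : x ∈ Icc (0 : ℝ) 1) : 0 < y x ^ 2 + p x ^ 2 := by
  have := (energy_bounds h.deriv h.dderiv hx).1
  rw [h.zero, h.dzero] at this
  exact pos_of_mul_pos_left (lt_of_lt_of_le (by norm_num) this) (Real.exp_pos _).le

theorem exists_solFun_ne_zero (q : CI) : ∃ x ∈ Ioo (0 : ℝ) 1, q.solFun x ≠ 0 := by
  by_contra! hy
  have hhalf' : (1 / 2 : ℝ) ∈ Ioo (0 : ℝ) 1 := by constructor <;> norm_num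
  have hhalf := Ioo_subset_Icc_self hhalf'
  have he : q.solFun =ᶠ[nhds (1 / 2)] fun _ => 0 := by
    filter_upwards [Ioo_mem_nhds hhalf'.1 hhalf'.2] with t ht using hy t ht
  have h5 := (q.isSol.deriv _ hhalf).unique
      ((hasDerivAt_const _ (0 : ℝ)).congr_of_eventuallyEq he)
  have h6 := q.isSol.energy_pos hhalf
  rw [h5, hy _ hhalf'] at h6
  norm_num at h6

/-- The difference of two solutions starts with zero energy, and the upper growth bound keeps it
zero. -/
theorem IsSol.eq_solFun {q : CI} {y p : ℝ → ℝ} (h : IsSol q y p) {x : ℝ}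
    (hx : x ∈ Icc (0 : ℝ) 1) : y x = q.solFun x := by
  have := (energy_bounds (q := q) (y := fun x => y x - q.solFun x)
    (p := fun x => p x - q.dsolFun x) (fun x hx => (h.deriv x hx).sub (q.isSol.deriv x hx))
    (fun x hx => ((h.dderiv x hx).sub (q.isSol.dderiv x hx)).congr_deriv (by ring)) hx).2
  simp only [h.zero, h.dzero, q.isSol.zero, q.isSol.dzero, sub_self] at this
  have h0 : (y x - q.solFun x) ^ 2 + (p x - q.dsolFun x) ^ 2 ≤ 0 := by
    by_contra! hc
    have := mul_pos hc (Real.exp_pos (-(1 + ‖q‖) * x))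
    linarith
  have : (y x - q.solFun x) ^ 2 = 0 :=
    le_antisymm (by linarith [sq_nonneg (p x - q.dsolFun x)]) (sq_nonneg _)
  exact sub_eq_zero.1 (pow_eq_zero_iff two_ne_zero |>.1 this)

/-! ### Linear first-order equations and the Prüfer angle. -/

/-- Integrating factor for `w' = a w + b`. -/
theorem hasDerivAt_mul_exp_neg_prim (a : CI) {w : ℝ → ℝ} {b x : ℝ}
    (h : HasDerivAt w (a.ext x * w x + b) x) :
    HasDerivAt (fun x => w x * Real.exp (-a.prim x)) (b * Real.exp (-a.prim x)) x :=
  (h.mul (a.hasDerivAt_prim x).neg.exp).congr_deriv (by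
    simp only [Pi.neg_apply]; ring)

theorem monotoneOn_mul_exp_neg_prim (a : CI) {w b : ℝ → ℝ}
    (h : ∀ x ∈ Icc (0 : ℝ) 1, HasDerivAt w (a.ext x * w x + b x) x)
    (hb : ∀ x ∈ Icc (0 : ℝ) 1, 0 ≤ b x) :
    MonotoneOn (fun x => w x * Real.exp (-a.prim x)) (Icc 0 1) :=
  monotoneOn_of_hasDerivAt_nonneg (fun x hx => hasDerivAt_mul_exp_neg_prim a (h x hx))
    fun x hx => mul_nonneg (hb x hx) (Real.exp_pos _).le

theorem nonneg_of_linear_ode (a : CI) {w b : ℝ → ℝ}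
    (h : ∀ x ∈ Icc (0 : ℝ) 1, HasDerivAt w (a.ext x * w x + b x) x)
    (hb : ∀ x ∈ Icc (0 : ℝ) 1, 0 ≤ b x) (h0 : w 0 = 0) {x : ℝ} (hx : x ∈ Icc (0 : ℝ) 1) :
    0 ≤ w x := by
  have := monotoneOn_mul_exp_neg_prim a h hb (by simp) hx hx.1
  simp only [h0, zero_mul] at this
  exact nonneg_of_mul_nonneg_left this (Real.exp_pos _)

theorem eq_zero_of_linear_ode (a : CI) {w : ℝ → ℝ}
    (h : ∀ x ∈ Icc (0 : ℝ) 1, HasDerivAt w (a.ext x * w x) x) (h0 : w 0 = 0) {x : ℝ}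
    (hx : x ∈ Icc (0 : ℝ) 1) : w x = 0 := by
  refine le_antisymm ?_ ?_
  · have := nonneg_of_linear_ode a (w := fun x => -w x) (b := fun _ => 0)
      (fun x hx => (h x hx).neg.congr_deriv (by ring)) (by simp) (by simp [h0]) hx
    linarith
  · exact nonneg_of_linear_ode a (b := fun _ => 0)
      (fun x hx => (h x hx).congr_deriv (by ring)) (by simp) h0 hx

/-- `y² + y'²` for `y = sol q`. -/
def energy (q : CI) : CI := sol q * sol q + dsol q * dsol q

theorem ext_energy (q : CI) {x : ℝ} (hx : x ∈ Icc (0 : ℝ) 1) :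
    q.energy.ext x = q.solFun x ^ 2 + q.dsolFun x ^ 2 := by
  rw [energy, ext_add, ext_mul, ext_mul, solFun_eq q hx, dsolFun_eq q hx]; ring

theorem isUnit_energy (q : CI) : IsUnit q.energy := by
  have h : ∀ x : Icc (0 : ℝ) 1, q.energy x ≠ 0 := fun x => by
    have := (q.isSol.energy_pos x.2).ne'
    rwa [← ext_energy q x.2, ext_of_mem _ x.2] at this
  refine IsUnit.of_mul_eq_one (⟨fun x => (q.energy x)⁻¹, q.energy.continuous_coe.inv₀ h⟩ :
    C(Icc (0 : ℝ) 1, ℝ)) ?_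
  ext x
  exact mul_inv_cancel₀ (h x)

/-- The derivative of the Prüfer angle of `sol q`. -/
def angleRate (q : CI) : CI :=
  (dsol q * dsol q - q * (sol q * sol q)) * Ring.inverse q.energy

/-- The Prüfer angle of `sol q`: a continuous argument of `y' + i y`. -/
def angle (q : CI) : ℝ → ℝ := q.angleRate.prim

theorem ext_inverse_energy (q : CI) {x : ℝ} (hx : x ∈ Icc (0 : ℝ) 1) :
    (Ring.inverse q.energy).ext x = (q.solFun x ^ 2 + q.dsolFun x ^ 2)⁻¹ := by
  have h := congrArg (fun f : CI => f.ext x) (Ring.mul_inverse_cancel _ q.isUnit_energy)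
  simp only [ext_mul, ext_one, ext_energy q hx] at h
  exact eq_inv_of_mul_eq_one_right h

theorem ext_angleRate (q : CI) {x : ℝ} (hx : x ∈ Icc (0 : ℝ) 1) :
    q.angleRate.ext x = (q.dsolFun x ^ 2 - q.ext x * q.solFun x ^ 2) /
      (q.solFun x ^ 2 + q.dsolFun x ^ 2) := by
  rw [angleRate, ext_mul, ext_inverse_energy q hx, ext_sub, ext_mul, ext_mul, ext_mul,
    solFun_eq q hx, dsolFun_eq q hx]
  ring

theorem hasDerivAt_angle (q : CI) (x : ℝ) : HasDerivAt q.angle (q.angleRate.ext x) x :=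
  q.angleRate.hasDerivAt_prim x

theorem angle_zero (q : CI) : q.angle 0 = 0 := prim_zero_right _

theorem continuous_angle (q : CI) : Continuous q.angle := q.angleRate.continuous_prim

/-- The angle was defined by integrating its rate, so it must be shown to be an argument of y' + iy.
With E = y² + y'², the left side satisfies w' = ((1 + q) y y' / E) w and w(0) = 0. -/
theorem sol_mul_cos_angle (q : CI) {x : ℝ} (hx : x ∈ Icc (0 : ℝ) 1) :
    q.solFun x * Real.cos (q.angle x) - q.dsolFun x * Real.sin (q.angle x) = 0 := by
  refine eq_zero_of_linear_ode ((1 + q) * (dsol q * sol q) * Ring.inverse q.energy)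
    (w := fun x => q.solFun x * Real.cos (q.angle x) - q.dsolFun x * Real.sin (q.angle x))
    (fun x hx => ?_) (by simp [angle_zero, q.isSol.zero]) hx
  have h1 := (q.isSol.deriv x hx).mul (q.hasDerivAt_angle x).cos
  have h2 := (q.isSol.dderiv x hx).mul (q.hasDerivAt_angle x).sin
  refine (h1.sub h2).congr_deriv ?_
  have hE := (q.isSol.energy_pos hx).ne'
  simp only [ext_mul, ext_add, ext_one, ext_inverse_energy q hx, ext_angleRate q hx,
    ← solFun_eq q hx, ← dsolFun_eq q hx]
  field_simp
  ring

theorem exists_polar (q : CI) {x : ℝ} (hx : x ∈ Icc (0 : ℝ) 1) :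
    ∃ v : ℝ, v ≠ 0 ∧ q.solFun x = v * Real.sin (q.angle x) ∧
      q.dsolFun x = v * Real.cos (q.angle x) := by
  have h := q.sol_mul_cos_angle hx
  have h1 := Real.sin_sq_add_cos_sq (q.angle x)
  have hE := (q.isSol.energy_pos hx).ne'
  set s := Real.sin (q.angle x)
  set c := Real.cos (q.angle x)
  set y := q.solFun x
  set p := q.dsolFun x
  have hy : y = (y * s + p * c) * s := by linear_combination (-y) * h1 + c * h
  have hp : p = (y * s + p * c) * c := by linear_combination (-p) * h1 - s * h
  refine ⟨y * s + p * c, fun h0 => hE ?_, hy, hp⟩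
  rw [h0, zero_mul] at hy hp
  rw [hy, hp]; ring

theorem sin_angle_eq_zero_iff (q : CI) {x : ℝ} (hx : x ∈ Icc (0 : ℝ) 1) :
    Real.sin (q.angle x) = 0 ↔ q.solFun x = 0 := by
  obtain ⟨v, hv, h, -⟩ := q.exists_polar hx
  simp [h, hv]

/-- The amplitude cancels, leaving a scalar first-order equation for the angle alone; comparison
rests on this form. -/
theorem ext_angleRate_eq (q : CI) {x : ℝ} (hx : x ∈ Icc (0 : ℝ) 1) :
    q.angleRate.ext x = 1 - (1 + q.ext x) * Real.sin (q.angle x) ^ 2 := by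
  obtain ⟨v, hv, h, h'⟩ := q.exists_polar hx
  rw [ext_angleRate q hx, h, h']
  have h1 := Real.sin_sq_add_cos_sq (q.angle x)
  have h2 : (v * Real.sin (q.angle x)) ^ 2 + (v * Real.cos (q.angle x)) ^ 2 = v ^ 2 := by
    linear_combination v ^ 2 * h1
  rw [h2]
  field_simp
  linear_combination h1

/-- Used to write sin x as a continuous coefficient times x, turning the nonlinear angle equation
into a linear one with continuous coefficient. -/
theorem mul_sinc (x : ℝ) : x * Real.sinc x = Real.sin x := by
  rcases eq_or_ne x 0 with rfl | h
  · simp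
  · rw [Real.sinc_of_ne_zero h]; field_simp

/-- With a = −(1 + q) sinc θ sin θ the equation is θ' = aθ + 1, and the forcing 1 pushes θ upward
from 0. -/
theorem angle_pos (q : CI) {x : ℝ} (hx : x ∈ Ioc (0 : ℝ) 1) : 0 < q.angle x := by
  set a : CI := -(1 + q) * ofCont (fun x => Real.sinc (q.angle x) * Real.sin (q.angle x))
    ((Real.continuous_sinc.comp q.continuous_angle).mul
      (Real.continuous_sin.comp q.continuous_angle)) with ha
  have hd : ∀ x ∈ Icc (0 : ℝ) 1, HasDerivAt q.angle (a.ext x * q.angle x + 1) x := by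
    intro x hx
    refine (q.hasDerivAt_angle x).congr_deriv ?_
    rw [q.ext_angleRate_eq hx, ha, neg_mul, ← neg_one_smul ℝ, ext_smul, ext_mul, ext_ofCont _ _ hx,
      ext_add, ext_one]
    linear_combination (1 + q.ext x) * Real.sin (q.angle x) * mul_sinc (q.angle x)
  have hm : StrictMonoOn (fun x => q.angle x * Real.exp (-a.prim x)) (Icc 0 1) := by
    refine strictMonoOn_of_deriv_pos (convex_Icc 0 1) ?_ fun x hx => ?_
    · exact (q.continuous_angle.mul (Real.continuous_exp.comp a.continuous_prim.neg)).continuousOn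
    · rw [(hasDerivAt_mul_exp_neg_prim a (hd x (interior_subset hx))).deriv]
      positivity
  have := hm (by simp) ⟨hx.1.le, hx.2⟩ hx.1
  simp only [angle_zero, zero_mul] at this
  exact pos_of_mul_pos_left this (Real.exp_pos _).le

/-! ### Sturm comparison and constant potentials. -/

/-- The difference θ₁ − θ₂ solves a linear equation with forcing (q₂ − q₁) sin²θ₂ ≥ 0 and starts at
0. The coefficient comes from sin²α − sin²β = sin(α − β) sin(α + β). -/
theorem angle_comparison {q₁ q₂ : CI} (h : ∀ x ∈ Icc (0 : ℝ) 1, q₁.ext x ≤ q₂.ext x) :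
    q₂.angle 1 ≤ q₁.angle 1 ∧
      ((∀ x ∈ Ioo (0 : ℝ) 1, q₁.ext x < q₂.ext x) → q₂.angle 1 < q₁.angle 1) := by
  set a : CI := -(1 + q₁) * ofCont
    (fun x => Real.sinc (q₁.angle x - q₂.angle x) * Real.sin (q₁.angle x + q₂.angle x))
    ((Real.continuous_sinc.comp (q₁.continuous_angle.sub q₂.continuous_angle)).mul
      (Real.continuous_sin.comp (q₁.continuous_angle.add q₂.continuous_angle))) with ha
  set b : ℝ → ℝ := fun x => (q₂.ext x - q₁.ext x) * Real.sin (q₂.angle x) ^ 2 with hb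
  have hd : ∀ x ∈ Icc (0 : ℝ) 1, HasDerivAt (fun x => q₁.angle x - q₂.angle x)
      (a.ext x * (q₁.angle x - q₂.angle x) + b x) x := by
    intro x hx
    refine ((q₁.hasDerivAt_angle x).sub (q₂.hasDerivAt_angle x)).congr_deriv ?_
    rw [q₁.ext_angleRate_eq hx, q₂.ext_angleRate_eq hx, ha, neg_mul, ← neg_one_smul ℝ, ext_smul,
      ext_mul, ext_ofCont _ _ hx, ext_add, ext_one, hb]
    have h1 : Real.sin (q₁.angle x) ^ 2 - Real.sin (q₂.angle x) ^ 2 =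
        Real.sin (q₁.angle x - q₂.angle x) * Real.sin (q₁.angle x + q₂.angle x) := by
      rw [Real.sin_sub, Real.sin_add]
      linear_combination Real.sin (q₂.angle x) ^ 2 * Real.sin_sq_add_cos_sq (q₁.angle x) -
        Real.sin (q₁.angle x) ^ 2 * Real.sin_sq_add_cos_sq (q₂.angle x)
    linear_combination (-(1 + q₁.ext x)) * h1 +
      (1 + q₁.ext x) * Real.sin (q₁.angle x + q₂.angle x) * mul_sinc (q₁.angle x - q₂.angle x)
  have hb0 : ∀ x ∈ Icc (0 : ℝ) 1, 0 ≤ b x := fun x hx =>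
    mul_nonneg (sub_nonneg.2 (h x hx)) (sq_nonneg _)
  have h1 := nonneg_of_linear_ode a hd hb0 (by simp [angle_zero]) (x := 1) (by simp)
  refine ⟨by linarith, fun hs => lt_of_le_of_ne (by linarith) fun heq => ?_⟩
  have hm := monotoneOn_mul_exp_neg_prim a hd hb0
  -- Equality at 1 forces this monotone function to vanish identically; then so does the forcing,
  -- hence sin θ₂ and the second solution vanish on (0, 1), which is impossible.
  have hz : ∀ x ∈ Icc (0 : ℝ) 1, (q₁.angle x - q₂.angle x) * Real.exp (-a.prim x) = 0 := by
    intro x hx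
    have h2 := hm (by simp) hx hx.1
    have h3 := hm hx (by simp) hx.2
    simp only [heq, angle_zero, sub_self, zero_mul] at h2 h3
    exact le_antisymm h3 h2
  have hy : ∀ x ∈ Ioo (0 : ℝ) 1, q₂.solFun x = 0 := by
    intro x hx
    have hx' := Ioo_subset_Icc_self hx
    have he : (fun x => (q₁.angle x - q₂.angle x) * Real.exp (-a.prim x)) =ᶠ[nhds x]
        fun _ => 0 := by
      filter_upwards [Ioo_mem_nhds hx.1 hx.2] with t ht using hz t (Ioo_subset_Icc_self ht)
    have h4 := (hasDerivAt_mul_exp_neg_prim a (hd x hx')).unique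
      ((hasDerivAt_const x (0 : ℝ)).congr_of_eventuallyEq he)
    rw [← q₂.sin_angle_eq_zero_iff hx']
    simpa [hb, (Real.exp_pos _).ne', sub_eq_zero, (hs x hx).ne'] using h4
  obtain ⟨x, hx, hne⟩ := q₂.exists_solFun_ne_zero
  exact hne (hy x hx)

theorem continuous_angle_one : Continuous fun q : CI => q.angle 1 := by
  have h1 : Continuous energy := by
    have := continuous_sol
    have := continuous_dsol
    unfold energy
    fun_prop
  have h2 : Continuous fun q : CI => Ring.inverse q.energy := by
    refine continuous_iff_continuousAt.2 fun q => ?_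
    have := NormedRing.inverse_continuousAt q.isUnit_energy.unit
    rw [IsUnit.unit_spec] at this
    exact this.comp (f := energy) h1.continuousAt
  have h3 : Continuous angleRate := by
    have := continuous_sol
    have := continuous_dsol
    unfold angleRate
    fun_prop
  exact (eval ⟨1, by simp⟩).continuous.comp (volterra.continuous.comp h3)


theorem ext_smul_one (c x : ℝ) : (c • (1 : CI)).ext x = c := by simp

theorem solFun_const (ω : ℝ) (hω : ω ≠ 0) {x : ℝ} (hx : x ∈ Icc (0 : ℝ) 1) :
    solFun ((-ω ^ 2) • 1) x = Real.sin (ω * x) / ω := by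
  refine (IsSol.eq_solFun (y := fun x => Real.sin (ω * x) / ω)
    (p := fun x => Real.cos (ω * x)) ⟨by simp, by simp, ?_, ?_⟩ hx).symm
  · intro x _
    refine (((hasDerivAt_id x).const_mul ω).sin.div_const ω).congr_deriv ?_
    simp only [id]; field_simp
  · intro x _
    refine (((hasDerivAt_id x).const_mul ω).cos).congr_deriv ?_
    simp only [id, ext_smul_one]; field_simp

/-- Comparison with q = −π²: its solution sin(πx)/π has no zero in (0, 1), so its angle cannot cross
π there. -/
theorem angle_one_le_pi {q : CI} (h : ∀ x ∈ Icc (0 : ℝ) 1, -Real.pi ^ 2 ≤ q.ext x) :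
    q.angle 1 ≤ Real.pi := by
  have h1 := (angle_comparison (q₁ := (-Real.pi ^ 2) • 1) (q₂ := q)
    (by simpa only [ext_smul_one] using h)).1
  refine h1.trans ?_
  set p : CI := (-Real.pi ^ 2) • 1 with hp
  by_contra! hc
  obtain ⟨x, hx, hxe⟩ := intermediate_value_Ioo zero_le_one p.continuous_angle.continuousOn
    (show Real.pi ∈ Ioo (p.angle 0) (p.angle 1) from ⟨by simp [angle_zero, Real.pi_pos], hc⟩)
  have h2 : p.solFun x = 0 := by
    rw [← p.sin_angle_eq_zero_iff (Ioo_subset_Icc_self hx), hxe, Real.sin_pi]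
  rw [hp, solFun_const _ Real.pi_ne_zero (Ioo_subset_Icc_self hx)] at h2
  have h3 : 0 < Real.sin (Real.pi * x) := Real.sin_pos_of_pos_of_lt_pi
    (mul_pos Real.pi_pos hx.1) (by nlinarith [Real.pi_pos, hx.2])
  exact (div_pos h3 Real.pi_pos).ne' h2

/-- Comparison with q = −(nπ)², whose solution vanishes at every j/n. -/
theorem le_angle_one {q : CI} (n : ℕ) (hn : 0 < n)
    (h : ∀ x ∈ Icc (0 : ℝ) 1, q.ext x ≤ -(n * Real.pi) ^ 2) : n * Real.pi ≤ q.angle 1 := by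
  have h1 := (angle_comparison (q₁ := q) (q₂ := (-(n * Real.pi) ^ 2) • 1)
    (by simpa only [ext_smul_one] using h)).1
  refine le_trans ?_ h1
  set p : CI := (-(n * Real.pi) ^ 2) • 1 with hp
  have hn' : (0 : ℝ) < n := mod_cast hn
  have hω : 0 < n * Real.pi := mul_pos hn' Real.pi_pos
  have hmono : StrictMonoOn p.angle (Icc 0 1) := by
    refine strictMonoOn_of_deriv_pos (convex_Icc 0 1) p.continuous_angle.continuousOn fun x hx => ?_
    rw [(p.hasDerivAt_angle x).deriv, ext_angleRate_eq _ (interior_subset hx), hp, ext_smul_one]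
    have h2 := Real.sin_sq_add_cos_sq (p.angle x)
    rw [← hp]
    rcases eq_or_ne (Real.sin (p.angle x)) 0 with h0 | h0
    · simp [h0]
    · have : 0 < (n * Real.pi) ^ 2 * Real.sin (p.angle x) ^ 2 := by positivity
      nlinarith [sq_nonneg (Real.cos (p.angle x))]
  -- At each j/n the angle is an integer multiple of π, and it increases strictly, so it gains at
  -- least π from one zero to the next.
  have key : ∀ j : ℕ, j ≤ n → j * Real.pi ≤ p.angle (j / n) := by
    intro j
    induction j with
    | zero => simp [angle_zero]
    | succ j ih =>
      intro hj
      have hj' : ((j : ℝ) + 1) ≤ n := mod_cast hj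
      have hm1 : (j : ℝ) / n ∈ Icc (0 : ℝ) 1 := ⟨by positivity, by
        rw [div_le_one hn']; linarith⟩
      have hm2 : ((j + 1 : ℕ) : ℝ) / n ∈ Icc (0 : ℝ) 1 := ⟨by positivity, by
        rw [div_le_one hn']; exact_mod_cast hj⟩
      have hlt := hmono hm1 hm2 (by gcongr; simp)
      have hs : Real.sin (p.angle ((j + 1 : ℕ) / n)) = 0 := by
        rw [p.sin_angle_eq_zero_iff hm2, hp, solFun_const _ hω.ne' hm2]
        rw [show (n : ℝ) * Real.pi * ((j + 1 : ℕ) / n) = (j + 1 : ℕ) * Real.pi by field_simp,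
          Real.sin_nat_mul_pi, zero_div]
      obtain ⟨m, hm⟩ := Real.sin_eq_zero_iff.1 hs
      have h3 := (ih (by omega)).trans_lt hlt
      rw [← hm] at h3 ⊢
      have h4 : (j : ℝ) < m := lt_of_mul_lt_mul_right h3 Real.pi_pos.le
      have h5 : (j : ℤ) + 1 ≤ m := by exact_mod_cast h4
      have h6 : ((j + 1 : ℕ) : ℝ) ≤ m := by exact_mod_cast h5
      gcongr
  simpa [hn'.ne'] using key n le_rfl

/-! ### Simplicity of the zeros of μ ↦ y(1). -/

/-- Lagrange's identity. -/
theorem wronskian (q₁ q₂ : CI) :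
    q₁.solFun 1 * q₂.dsolFun 1 - q₁.dsolFun 1 * q₂.solFun 1 =
      ((q₂ - q₁) * (sol q₁ * sol q₂)).prim 1 := by
  have hd : ∀ x ∈ uIcc (0 : ℝ) 1, HasDerivAt
      (fun x => q₁.solFun x * q₂.dsolFun x - q₁.dsolFun x * q₂.solFun x)
      (((q₂ - q₁) * (sol q₁ * sol q₂)).ext x) x := by
    intro x hx
    rw [uIcc_of_le zero_le_one] at hx
    refine (((q₁.isSol.deriv x hx).mul (q₂.isSol.dderiv x hx)).sub
      ((q₁.isSol.dderiv x hx).mul (q₂.isSol.deriv x hx))).congr_deriv ?_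
    simp only [ext_mul, ext_sub, ← solFun_eq _ hx]
    ring
  rw [prim, intervalIntegral.integral_eq_sub_of_hasDerivAt hd
    ((continuous_ext _).intervalIntegrable _ _)]
  simp [q₁.isSol.zero, q₂.isSol.zero]

theorem integral_sol_sq_pos (q : CI) : 0 < (sol q * sol q).prim 1 := by
  refine intervalIntegral.integral_pos zero_lt_one (continuous_ext _).continuousOn
    (fun x _ => ?_) ?_
  · rw [ext_mul]; exact mul_self_nonneg _
  · obtain ⟨x, hx, hne⟩ := q.exists_solFun_ne_zero
    have hx' := Ioo_subset_Icc_self hx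
    refine ⟨x, hx', ?_⟩
    rw [ext_mul, ← solFun_eq _ hx']
    exact mul_self_pos.2 hne

/-- The derivative of `c ↦ y(1)` for the solution of `y'' = (q - c) y`. -/
theorem exists_hasDerivAt_solFun_one (q : CI) (μ : ℝ) (h : solFun (q - μ • 1) 1 = 0) :
    ∃ d : ℝ, d ≠ 0 ∧ HasDerivAt (fun c : ℝ => solFun (q - c • 1) 1) d μ := by
  have h01 : (1 : ℝ) ∈ Icc (0 : ℝ) 1 := by simp
  set q₁ := q - μ • (1 : CI) with hq₁
  have hp : q₁.dsolFun 1 ≠ 0 := fun h0 => by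
    have := q₁.isSol.energy_pos h01
    rw [h, h0] at this
    norm_num at this
  set G : ℝ → ℝ := fun c => (sol q₁ * sol (q - c • 1)).prim 1 / q₁.dsolFun 1 with hG
  -- Lagrange's identity between the parameters μ and c, with y(1) = 0 at μ. The derivative at μ is
  -- then G μ, for which continuity of G suffices.
  have hF : ∀ c, solFun (q - c • 1) 1 = (c - μ) * G c := by
    intro c
    have := wronskian q₁ (q - c • 1)
    rw [show q - c • (1 : CI) - q₁ = (μ - c) • (1 : CI) by rw [hq₁, sub_smul]; abel,
      smul_mul_assoc, one_mul, h, prim] at this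
    simp only [ext_smul] at this
    rw [intervalIntegral.integral_const_mul] at this
    rw [hG]
    simp only [prim]
    field_simp
    linarith
  have hGc : Continuous G := by
    have h1 : Continuous fun c : ℝ => sol q₁ * sol (q - c • 1) :=
      continuous_const.mul (continuous_sol.comp (by fun_prop))
    exact ((eval ⟨1, by simp⟩).continuous.comp (volterra.continuous.comp h1)).div_const _
  refine ⟨G μ, div_ne_zero (integral_sol_sq_pos q₁).ne' hp, ?_⟩
  rw [hasDerivAt_iff_tendsto_slope]
  refine (hGc.tendsto μ |>.mono_left nhdsWithin_le_nhds).congr' ?_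
  filter_upwards [self_mem_nhdsWithin] with c hc
  rw [slope_def_field, hF, hF, sub_self, zero_mul, sub_zero,
    mul_div_cancel_left₀ _ (sub_ne_zero.2 hc)]

/-! ### The eigenvalue curves. -/

theorem continuous_phi1 : Continuous phi1 := by unfold phi1; fun_prop

theorem phi1_sq_mem (x : ℝ) : phi1 x ^ 2 ∈ Icc (0 : ℝ) 2 := by
  refine ⟨sq_nonneg _, ?_⟩
  have := Real.sin_sq_le_one (Real.pi * x)
  rw [phi1, mul_pow, Real.sq_sqrt (by norm_num)]
  linarith

theorem phi1_pos {x : ℝ} (hx : x ∈ Ioo (0 : ℝ) 1) : 0 < phi1 x :=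
  mul_pos (by positivity) (Real.sin_pos_of_pos_of_lt_pi
    (mul_pos Real.pi_pos hx.1) (by nlinarith [Real.pi_pos, hx.2]))

/-- The potential `2 κ φ₁² - π² - μ`, for which `A_κ g = μ g` reads `g'' = q g`. -/
def pot (κ μ : ℝ) : CI :=
  κ • ofCont (fun x => 2 * phi1 x ^ 2) (by have := continuous_phi1; fun_prop) -
    (Real.pi ^ 2) • 1 - μ • 1

theorem ext_pot (κ μ : ℝ) {x : ℝ} (hx : x ∈ Icc (0 : ℝ) 1) :
    (pot κ μ).ext x = 2 * κ * phi1 x ^ 2 - Real.pi ^ 2 - μ := by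
  rw [pot, ext_sub, ext_sub, ext_smul, ext_smul_one, ext_smul_one, ext_ofCont _ _ hx]
  ring

theorem strictMono_angle_pot (κ : ℝ) : StrictMono fun μ => (pot κ μ).angle 1 := by
  intro μ μ' h
  refine (angle_comparison (q₁ := pot κ μ') (q₂ := pot κ μ) fun x hx => ?_).2 fun x hx => ?_
  · rw [ext_pot _ _ hx, ext_pot _ _ hx]; linarith
  · rw [ext_pot _ _ (Ioo_subset_Icc_self hx), ext_pot _ _ (Ioo_subset_Icc_self hx)]; linarith

theorem angle_pot_lt {κ κ' : ℝ} (h : κ < κ') (μ : ℝ) :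
    (pot κ' μ).angle 1 < (pot κ μ).angle 1 := by
  refine (angle_comparison (q₁ := pot κ μ) (q₂ := pot κ' μ) fun x hx => ?_).2 fun x hx => ?_
  · rw [ext_pot _ _ hx, ext_pot _ _ hx]
    nlinarith [(phi1_sq_mem x).1]
  · rw [ext_pot _ _ (Ioo_subset_Icc_self hx), ext_pot _ _ (Ioo_subset_Icc_self hx)]
    nlinarith [pow_pos (phi1_pos hx) 2]

/-- As 2φ₁² ≤ 4, raising μ by 4(κ' − κ) outweighs the growth of the potential in κ; this becomes the
Lipschitz bound for the eigenvalues. -/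
theorem angle_pot_le_add {κ κ' : ℝ} (h : κ ≤ κ') (μ : ℝ) :
    (pot κ μ).angle 1 ≤ (pot κ' (μ + 4 * (κ' - κ))).angle 1 := by
  refine (angle_comparison fun x hx => ?_).1
  rw [ext_pot _ _ hx, ext_pot _ _ hx]
  nlinarith [(phi1_sq_mem x).2]

theorem exists_angle_pot_eq (k : ℕ+) (κ : ℝ) :
    ∃ μ, (pot κ μ).angle 1 = (k : ℕ) * Real.pi := by
  have hc : Continuous fun μ => (pot κ μ).angle 1 :=
    continuous_angle_one.comp (by unfold pot; fun_prop)
  have hb : ∀ x, |2 * κ * phi1 x ^ 2| ≤ 4 * |κ| := by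
    intro x
    have h2 := phi1_sq_mem x
    rw [abs_mul, abs_mul, abs_of_nonneg h2.1, abs_two]
    nlinarith [abs_nonneg κ, h2.2]
  -- Since |2κφ₁²| ≤ 4|κ|, the lower choice of μ gives q ≥ −π², and the upper one gives q ≤ −(kπ)².
  refine mem_range_of_exists_le_of_exists_ge hc ⟨-(4 * |κ|), ?_⟩
    ⟨4 * |κ| + ((k : ℕ) * Real.pi) ^ 2, ?_⟩
  · refine (angle_one_le_pi fun x hx => ?_).trans
      (le_mul_of_one_le_left Real.pi_pos.le (Nat.one_le_cast.2 k.pos))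
    rw [ext_pot _ _ hx]
    linarith [abs_le.1 (hb x)]
  · refine le_angle_one _ k.pos fun x hx => ?_
    rw [ext_pot _ _ hx]
    linarith [abs_le.1 (hb x), sq_nonneg Real.pi]

/-- The `k`-th eigenvalue of `A_κ`, defined through the Prüfer angle. -/
def eig (k : ℕ+) (κ : ℝ) : ℝ := (exists_angle_pot_eq k κ).choose

theorem angle_eig (k : ℕ+) (κ : ℝ) : (pot κ (eig k κ)).angle 1 = (k : ℕ) * Real.pi :=
  (exists_angle_pot_eq k κ).choose_spec

theorem strictMono_eig_index (κ : ℝ) : StrictMono fun k => eig k κ := by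
  intro k l h
  rw [← (strictMono_angle_pot κ).lt_iff_lt, angle_eig, angle_eig]
  have : ((k : ℕ) : ℝ) < (l : ℕ) := mod_cast h
  exact mul_lt_mul_of_pos_right this Real.pi_pos

theorem strictMono_eig (k : ℕ+) : StrictMono (eig k) := by
  intro κ κ' h
  rw [← (strictMono_angle_pot κ').lt_iff_lt, angle_eig, ← angle_eig k κ]
  exact angle_pot_lt h _

theorem eig_le_add (k : ℕ+) {κ κ' : ℝ} (h : κ ≤ κ') : eig k κ' ≤ eig k κ + 4 * (κ' - κ) := by
  rw [← (strictMono_angle_pot κ').le_iff_le, angle_eig, ← angle_eig k κ]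
  exact angle_pot_le_add h _

theorem continuous_eig (k : ℕ+) : Continuous (eig k) := by
  refine (LipschitzWith.of_le_add_mul 4 fun κ κ' => ?_).continuous
  rw [Real.dist_eq]
  rcases le_total κ κ' with h | h
  · have := (strictMono_eig k).monotone h
    have : (0 : ℝ) ≤ (4 : NNReal) * |κ - κ'| := by positivity
    linarith
  · rw [abs_of_nonneg (sub_nonneg.2 h)]
    exact eig_le_add k h

theorem solFun_eig (k : ℕ+) (κ : ℝ) : (pot κ (eig k κ)).solFun 1 = 0 := by
  rw [← sin_angle_eq_zero_iff _ (by simp), angle_eig, Real.sin_nat_mul_pi]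

/-- A zero y(1) = 0 makes θ(1) an integer multiple of π, positive by `angle_pos`; injectivity of
θ(1) in μ identifies the eigenvalue. -/
theorem range_eig (κ : ℝ) : range (fun k => eig k κ) = {μ | (pot κ μ).solFun 1 = 0} := by
  refine Subset.antisymm (range_subset_iff.2 fun k => solFun_eig k κ) fun μ hμ => ?_
  rw [mem_ofPred_eq, ← sin_angle_eq_zero_iff _ (by simp)] at hμ
  obtain ⟨m, hm⟩ := Real.sin_eq_zero_iff.1 hμ
  have hpos := (pot κ μ).angle_pos (x := 1) (by simp)
  rw [← hm] at hpos
  have hm0 : 0 < m := by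
    have := pos_of_mul_pos_left hpos Real.pi_pos.le
    exact_mod_cast this
  lift m to ℕ using hm0.le
  refine ⟨⟨m, by exact_mod_cast hm0⟩, (strictMono_angle_pot κ).injective ?_⟩
  exact (angle_eig _ _).trans (by simpa using hm)

/-- For κ = μ = 0 the potential is the constant −π², so θ(1) ≤ π ≤ kπ. -/
theorem eig_zero_nonneg (k : ℕ+) : 0 ≤ eig k 0 := by
  rw [← (strictMono_angle_pot 0).le_iff_le, angle_eig]
  refine (angle_one_le_pi fun x hx => ?_).trans
    (le_mul_of_one_le_left Real.pi_pos.le (Nat.one_le_cast.2 k.pos))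
  rw [ext_pot _ _ hx]; simp

theorem solFun_one_eq_eval (q : CI) : q.solFun 1 = eval ⟨1, by simp⟩ (sol q) := by
  rw [solFun_eq _ (by simp), ext_of_mem _ (by simp)]; rfl

theorem analyticAt_eig (k : ℕ+) (κ : ℝ) : AnalyticAt ℝ (eig k) κ := by
  set f : ℝ × ℝ → ℝ := fun v => (pot v.1 v.2).solFun 1 with hf
  set u : ℝ × ℝ := (κ, eig k κ) with hu
  have hfa : AnalyticAt ℝ f u := by
    have h1 : AnalyticAt ℝ (fun v : ℝ × ℝ => pot v.1 v.2) u :=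
      ((analyticAt_fst.smul analyticAt_const).sub analyticAt_const).sub
        (analyticAt_snd.smul analyticAt_const)
    have h2 := (analyticAt_sol (pot u.1 u.2)).fun_comp (f := fun v : ℝ × ℝ => pot v.1 v.2) h1
    simp only [hf, solFun_one_eq_eval]
    exact ((eval ⟨1, by simp⟩).analyticAt _).fun_comp h2
  have hcd : ContDiffAt ℝ ⊤ f u := hfa.contDiffAt
  obtain ⟨d, hd0, hd⟩ := exists_hasDerivAt_solFun_one (pot κ 0) (eig k κ) (by
    simpa [pot] using solFun_eig k κ)
  have hd' : HasDerivAt (fun c => f (κ, c)) d (eig k κ) := by simpa [hf, pot] using hd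
  have hd2 : HasDerivAt (fun c => f (κ, c)) (fderiv ℝ f u (0, 1)) (eig k κ) :=
    hfa.differentiableAt.hasFDerivAt.comp_hasDerivAt (eig k κ)
      ((hasDerivAt_const _ κ).prodMk (hasDerivAt_id _))
  have hinv : (fderiv ℝ f u ∘L .inr ℝ ℝ ℝ).IsInvertible := by
    refine ⟨ContinuousLinearEquiv.unitsEquivAut ℝ (Units.mk0 d hd0), ?_⟩
    ext
    simp [hd'.unique hd2]
  -- Near u, the zeros of f are exactly the graph of the implicit function; continuity of `eig k`
  -- keeps its graph in that neighbourhood.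
  have hev := hcd.eventually_apply_eq_iff_implicitFunction (by simp) hinv
  have ht : Filter.Tendsto (fun c => (c, eig k c)) (nhds κ) (nhds u) :=
    (continuous_id.prodMk (continuous_eig k)).tendsto κ
  have han := (hcd.contDiffAt_implicitFunction (by simp) hinv).analyticAt
  refine han.congr ?_
  filter_upwards [ht.eventually hev] with c hc
  exact hc.1 ((solFun_eig k c).trans (solFun_eig k κ).symm)

end CI

/-! ### Test functions. -/

theorem IsTestFun.zero : IsTestFun 0 :=
  ⟨contDiff_const, HasCompactSupport.zero, by simp⟩

theorem IsTestFun.add {φ ψ : ℝ → ℝ} (h : IsTestFun φ) (h' : IsTestFun ψ) : IsTestFun (φ + ψ) :=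
  ⟨h.1.add h'.1, h.2.1.add h'.2.1, (tsupport_add _ _).trans (union_subset h.2.2 h'.2.2)⟩

theorem IsTestFun.smul (c : ℝ) {φ : ℝ → ℝ} (h : IsTestFun φ) : IsTestFun (c • φ) :=
  have hs : tsupport (c • φ) ⊆ tsupport φ := closure_mono (Function.support_const_smul_subset c φ)
  ⟨h.1.const_smul c, h.2.1.of_isClosed_subset (isClosed_tsupport _) hs, hs.trans h.2.2⟩

theorem IsTestFun.eq_zero {φ : ℝ → ℝ} (h : IsTestFun φ) {x : ℝ} (hx : x ∉ Ioo (0 : ℝ) 1) :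
    φ x = 0 :=
  image_eq_zero_of_notMem_tsupport fun hh => hx (h.2.2 hh)

theorem IsTestFun.continuous_deriv {φ : ℝ → ℝ} (h : IsTestFun φ) : Continuous (deriv φ) :=
  h.1.continuous_deriv (by simp)

theorem IsTestFun.hasDerivAt {φ : ℝ → ℝ} (h : IsTestFun φ) (x : ℝ) :
    HasDerivAt φ (deriv φ x) x :=
  (h.1.differentiable (by simp)).differentiableAt.hasDerivAt

theorem exists_Icc_of_isCompact_subset_Ioo {K : Set ℝ} (hK : IsCompact K) (h : K ⊆ Ioo 0 1) :
    ∃ a b : ℝ, 0 < a ∧ b < 1 ∧ K ⊆ Icc a b := by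
  rcases K.eq_empty_or_nonempty with rfl | hne
  · exact ⟨1 / 2, 1 / 2, by norm_num, by norm_num, empty_subset _⟩
  · obtain ⟨a, ha⟩ := hK.exists_isLeast hne
    obtain ⟨b, hb⟩ := hK.exists_isGreatest hne
    exact ⟨a, b, (h ha.1).1, (h hb.1).2, fun x hx => ⟨ha.2 hx, hb.2 hx⟩⟩

/-- A test function of mean zero has a test function as a primitive. -/
theorem IsTestFun.primitive {η : ℝ → ℝ} (h : IsTestFun η) (h0 : ∫ x in (0 : ℝ)..1, η x = 0) :
    IsTestFun (fun x => ∫ t in (0 : ℝ)..x, η t) := by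
  have hd : ∀ x, HasDerivAt (fun x => ∫ t in (0 : ℝ)..x, η t) (η x) x := fun x =>
    (h.1.continuous.integral_hasStrictDerivAt 0 x).hasDerivAt
  obtain ⟨a, b, ha, hb, hab⟩ := exists_Icc_of_isCompact_subset_Ioo h.2.1 h.2.2
  have hz : ∀ x, x ∉ Icc a b → η x = 0 := fun x hx =>
    image_eq_zero_of_notMem_tsupport fun hh => hx (hab hh)
  -- Left of a the integrand vanishes; right of b the integral from x to 1 vanishes, and the
  -- mean-zero hypothesis does the rest.
  have hz' : ∀ x, x ∉ Icc a b → ∫ t in (0 : ℝ)..x, η t = 0 := by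
    intro x hx
    rw [mem_Icc, not_and_or, not_le, not_le] at hx
    rcases hx with hx | hx
    · refine intervalIntegral.integral_zero_ae (.of_forall fun t ht => hz t fun ht' => ?_)
      rcases le_total 0 x with h1 | h1
      · rw [uIoc_of_le h1] at ht; linarith [ht.2, ht'.1]
      · rw [uIoc_of_ge h1] at ht; linarith [ht.2, ht'.1]
    · have h1 : ∫ t in x..1, η t = 0 := by
        refine intervalIntegral.integral_zero_ae (.of_forall fun t ht => hz t fun ht' => ?_)
        rcases le_total x 1 with h1 | h1
        · rw [uIoc_of_le h1] at ht; linarith [ht.1, ht'.2]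
        · rw [uIoc_of_ge h1] at ht; linarith [ht.1, ht'.2]
      have h2 := intervalIntegral.integral_add_adjacent_intervals
        (h.1.continuous.intervalIntegrable (μ := volume) 0 x)
        (h.1.continuous.intervalIntegrable (μ := volume) x 1)
      linarith
  have hs : tsupport (fun x => ∫ t in (0 : ℝ)..x, η t) ⊆ Icc a b :=
    closure_minimal (fun x hx => by_contra fun hc => hx (hz' x hc)) isClosed_Icc
  refine ⟨?_, isCompact_Icc.of_isClosed_subset (isClosed_tsupport _) hs,
    hs.trans fun x hx => ⟨ha.trans_le hx.1, hx.2.trans_lt hb⟩⟩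
  rw [contDiff_infty_iff_deriv]
  refine ⟨fun x => (hd x).differentiableAt, ?_⟩
  rw [funext fun x => (hd x).deriv]
  exact h.1

theorem setIntegral_Ioo_eq (f : ℝ → ℝ) : ∫ x in Ioo (0 : ℝ) 1, f x = ∫ x in (0 : ℝ)..1, f x := by
  rw [intervalIntegral.integral_of_le zero_le_one, integral_Ioc_eq_integral_Ioo]

theorem exists_isTestFun_integral_eq_one :
    ∃ χ : ℝ → ℝ, IsTestFun χ ∧ ∫ x in (0 : ℝ)..1, χ x = 1 := by
  let f : ContDiffBump (1 / 2 : ℝ) := ⟨1 / 8, 1 / 4, by norm_num, by norm_num⟩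
  have ht : IsTestFun (f.normed volume) := by
    refine ⟨f.contDiff_normed, f.hasCompactSupport_normed, ?_⟩
    rw [f.tsupport_normed_eq, Real.closedBall_eq_Icc]
    exact fun x hx => ⟨by norm_num [f] at hx; linarith [hx.1],
      by norm_num [f] at hx; linarith [hx.2]⟩
  refine ⟨_, ht, ?_⟩
  rw [← setIntegral_Ioo_eq, setIntegral_eq_integral_of_forall_compl_eq_zero
    fun x hx => ht.eq_zero hx,
    f.integral_normed]

/-- An element of `L²(I)` orthogonal to all test functions vanishes. -/
theorem L2I.eq_zero_of_forall_test {g : L2I}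
    (h : ∀ φ, IsTestFun φ → ∫ x in Ioo (0 : ℝ) 1, g x * φ x = 0) : g = 0 := by
  have hint : IntegrableOn (fun x => g x) (Ioo (0 : ℝ) 1) volume :=
    (Lp.memLp g).integrable (by norm_num)
  have key := isOpen_Ioo.ae_eq_zero_of_integral_contDiff_smul_eq_zero
    (μ := volume) hint.locallyIntegrableOn (by
      intro φ h1 h2 h3
      have hφ : IsTestFun φ := ⟨h1, h2, h3⟩
      have := h φ hφ
      rw [setIntegral_eq_integral_of_forall_compl_eq_zero
        fun x hx => by rw [hφ.eq_zero hx, mul_zero]] at this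
      simpa [mul_comm] using this)
  rw [Lp.eq_zero_iff_ae_eq_zero, Filter.EventuallyEq, ae_restrict_iff' measurableSet_Ioo]
  exact key

/-! ### C[0, 1] inside L², and approximation in H¹₀. -/

namespace CI

theorem memLp_ext (f : CI) : MemLp f.ext 2 (volume.restrict (Ioo (0 : ℝ) 1)) :=
  MemLp.of_bound f.continuous_ext.aestronglyMeasurable ‖f‖ (.of_forall f.abs_ext_le)

/-- The inclusion of `C[0, 1]` in `L²(I)`. -/
def toL2 : CI →ₗ[ℝ] L2I where
  toFun f := f.memLp_ext.toLp _
  map_add' f g := MemLp.toLp_add f.memLp_ext g.memLp_ext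
  map_smul' c f := MemLp.toLp_const_smul c f.memLp_ext

theorem coeFn_toL2 (f : CI) : toL2 f =ᵐ[volume.restrict (Ioo (0 : ℝ) 1)] f.ext :=
  f.memLp_ext.coeFn_toLp

theorem inner_eq (u v : L2I) : inner ℝ u v = ∫ x in Ioo (0 : ℝ) 1, u x * v x := by
  rw [L2.inner_def]
  simp [mul_comm]

theorem inner_toL2_right (g : L2I) (f : CI) :
    inner ℝ g (toL2 f) = ∫ x in Ioo (0 : ℝ) 1, g x * f.ext x := by
  rw [inner_eq]
  refine integral_congr_ae ?_
  filter_upwards [coeFn_toL2 f] with x hx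
  rw [hx]

theorem inner_toL2_toL2 (f g : CI) : inner ℝ (toL2 f) (toL2 g) = (f * g).prim 1 := by
  rw [inner_toL2_right, prim, ← setIntegral_Ioo_eq]
  refine integral_congr_ae ?_
  filter_upwards [coeFn_toL2 f] with x hx
  rw [hx, ext_mul]

theorem norm_toL2_sq (f : CI) : ‖toL2 f‖ ^ 2 = (f * f).prim 1 := by
  rw [← real_inner_self_eq_norm_sq, inner_toL2_toL2]

theorem norm_toL2_le {f : CI} {C : ℝ} (hC : 0 ≤ C) (h : ∀ x ∈ Icc (0 : ℝ) 1, |f.ext x| ≤ C) :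
    ‖toL2 f‖ ≤ C := by
  have h1 := abs_prim_le (f := f * f) (C := C ^ 2) (n := 0) (x := 1) (fun t ht => by
    rw [ext_mul, ← sq, abs_pow]
    simpa using pow_le_pow_left₀ (abs_nonneg _) (h t ht) 2) (by simp)
  refine (pow_le_pow_iff_left₀ (norm_nonneg _) hC two_ne_zero).1 ?_
  rw [norm_toL2_sq]
  simpa using (abs_le.1 h1).2

/-- Cauchy–Schwarz for |f| against 1. Thus L² convergence of derivatives controls the primitives. -/
theorem abs_prim_le_norm_toL2 (f : CI) {x : ℝ} (hx : x ∈ Icc (0 : ℝ) 1) :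
    |f.prim x| ≤ ‖toL2 f‖ := by
  set a : CI := ofCont (fun x => |f.ext x|) f.continuous_ext.abs with ha
  have h1 : |f.prim x| ≤ a.prim 1 := by
    have h2 : ‖∫ t in (0 : ℝ)..x, f.ext t‖ ≤ ∫ t in (0 : ℝ)..x, |f.ext t| :=
      intervalIntegral.norm_integral_le_integral_norm hx.1
    refine h2.trans ?_
    have h3 : a.prim 1 = ∫ t in (0 : ℝ)..1, |f.ext t| := by
      refine intervalIntegral.integral_congr fun t ht => ?_
      rw [uIcc_of_le zero_le_one] at ht
      rw [ha, ext_ofCont _ _ ht]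
    rw [h3]
    exact intervalIntegral.integral_mono_interval le_rfl hx.1 hx.2
      (.of_forall fun _ => abs_nonneg _) (f.continuous_ext.abs.intervalIntegrable _ _)
  have h4 : a * a = f * f := by
    ext x
    change |f.ext x| * |f.ext x| = f x * f x
    rw [abs_mul_abs_self, ext_of_mem _ x.2]
  have h5 : ‖toL2 a‖ = ‖toL2 f‖ := by
    rw [← sq_eq_sq₀ (norm_nonneg _) (norm_nonneg _), norm_toL2_sq, norm_toL2_sq, h4]
  have h6 : ‖toL2 1‖ ≤ 1 := norm_toL2_le zero_le_one (by simp)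
  have h7 := real_inner_le_norm (toL2 1) (toL2 a)
  rw [inner_toL2_toL2, one_mul, h5] at h7
  exact h1.trans (h7.trans (mul_le_of_le_one_left (norm_nonneg _) h6))

theorem norm_toL2_volterra_le (f : CI) : ‖toL2 (volterra f)‖ ≤ ‖toL2 f‖ :=
  norm_toL2_le (norm_nonneg _) fun x hx => by
    rw [ext_volterra _ hx]; exact abs_prim_le_norm_toL2 f hx

/-- The test functions, as a subspace of `L²(I)`. -/
def testSubmodule : Submodule ℝ L2I where
  carrier := {u | ∃ φ, ∃ h : IsTestFun φ, u = toL2 (ofCont φ h.1.continuous)}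
  add_mem' := by
    rintro _ _ ⟨φ, h, rfl⟩ ⟨ψ, h', rfl⟩
    exact ⟨φ + ψ, h.add h', (map_add _ _ _).symm⟩
  zero_mem' := ⟨0, IsTestFun.zero, (map_zero toL2).symm⟩
  smul_mem' := by
    rintro c _ ⟨φ, h, rfl⟩
    exact ⟨c • φ, h.smul c, (map_smul _ _ _).symm⟩

theorem setIntegral_mul_ext_ofCont (g : L2I) (φ : ℝ → ℝ) (h : Continuous φ) :
    ∫ x in Ioo (0 : ℝ) 1, g x * (ofCont φ h).ext x = ∫ x in Ioo (0 : ℝ) 1, g x * φ x :=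
  setIntegral_congr_fun measurableSet_Ioo fun x hx => by
    simp only [ext_ofCont _ _ (Ioo_subset_Icc_self hx)]

theorem dense_testSubmodule : testSubmodule.topologicalClosure = ⊤ := by
  rw [Submodule.topologicalClosure_eq_top_iff, Submodule.eq_bot_iff]
  intro g hg
  refine L2I.eq_zero_of_forall_test fun φ h => ?_
  rw [← setIntegral_mul_ext_ofCont _ _ h.1.continuous, ← inner_toL2_right, real_inner_comm]
  exact hg _ ⟨φ, h, rfl⟩

/-- The pairs `(φ, φ')`, `φ` a test function. -/
def testPairs : Set (L2I × L2I) :=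
  {p : L2I × L2I | ∃ φ : ℝ → ℝ, IsTestFun φ ∧
      p.1 =ᵐ[volume.restrict (Ioo (0 : ℝ) 1)] φ ∧
      p.2 =ᵐ[volume.restrict (Ioo (0 : ℝ) 1)] deriv φ}

theorem toL2_ofCont_ae (φ : ℝ → ℝ) (h : Continuous φ) :
    toL2 (ofCont φ h) =ᵐ[volume.restrict (Ioo (0 : ℝ) 1)] φ := by
  filter_upwards [coeFn_toL2 (ofCont φ h), ae_restrict_mem measurableSet_Ioo] with x hx hx'
  rw [hx, ext_ofCont _ _ (Ioo_subset_Icc_self hx')]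

theorem prim_ofCont (φ : ℝ → ℝ) (h : Continuous φ) {x : ℝ} (hx : x ∈ Icc (0 : ℝ) 1) :
    (ofCont φ h).prim x = ∫ t in (0 : ℝ)..x, φ t := by
  refine intervalIntegral.integral_congr fun t ht => ?_
  rw [uIcc_of_le hx.1] at ht
  exact ext_ofCont _ _ ⟨ht.1, ht.2.trans hx.2⟩

theorem mem_testPairs {η : ℝ → ℝ} (h : IsTestFun η) (h0 : ∫ x in (0 : ℝ)..1, η x = 0) :
    (toL2 (volterra (ofCont η h.1.continuous)), toL2 (ofCont η h.1.continuous)) ∈ testPairs := by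
  have hp := h.primitive h0
  refine ⟨_, hp, ?_, ?_⟩
  · have : volterra (ofCont η h.1.continuous) = ofCont _ hp.1.continuous := by
      ext x
      exact prim_ofCont _ _ x.2
    simp only [this]
    exact toL2_ofCont_ae _ _
  · have hd : deriv (fun x => ∫ t in (0 : ℝ)..x, η t) = η := funext fun x =>
      (h.1.continuous.integral_hasStrictDerivAt 0 x).hasDerivAt.deriv
    rw [hd]
    exact toL2_ofCont_ae _ _

/-- The primitives in `C¹[0, 1]` vanishing at both ends are limits of test functions in `H¹`. -/
theorem mem_closure_testPairs {w : CI} (hw : w.prim 1 = 0) :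
    (toL2 (volterra w), toL2 w) ∈ (Submodule.span ℝ testPairs).topologicalClosure := by
  obtain ⟨χ, hχ, hχ1⟩ := exists_isTestFun_integral_eq_one
  set c : CI := ofCont χ hχ.1.continuous with hc
  rw [← SetLike.mem_coe, Submodule.topologicalClosure_coe, Metric.mem_closure_iff]
  intro ε hε
  have hB : 0 < 1 + ‖toL2 c‖ := by positivity
  have hmem : toL2 w ∈ closure (testSubmodule : Set L2I) := by
    rw [← Submodule.topologicalClosure_coe, dense_testSubmodule]; trivial
  obtain ⟨_, ⟨ψ, hψ, rfl⟩, hψd⟩ := Metric.mem_closure_iff.1 hmem _ (div_pos hε hB)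
  set s : CI := ofCont ψ hψ.1.continuous with hs
  set m : ℝ := ∫ x in (0 : ℝ)..1, ψ x with hm
  -- Subtracting mχ restores mean zero, so the primitive is again a test function.
  have hη := hψ.add (hχ.smul (-m))
  have hη0 : ∫ x in (0 : ℝ)..1, (ψ + (-m) • χ) x = 0 := by
    simp only [Pi.add_apply, Pi.smul_apply, smul_eq_mul]
    rw [intervalIntegral.integral_add (hψ.1.continuous.intervalIntegrable _ _)
      ((hχ.1.continuous.const_mul _).intervalIntegrable _ _),
      intervalIntegral.integral_const_mul, hχ1]
    simp [hm]
  refine ⟨_, Submodule.subset_span (mem_testPairs hη hη0), ?_⟩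
  have he : ofCont (ψ + (-m) • χ) hη.1.continuous = s - m • c := by
    ext x
    change ψ x + (-m) * χ x = ψ x - m * χ x
    ring
  -- The correction is as small as the approximation error because w itself has mean zero; the
  -- factor 1 + ‖χ‖ in the choice of ψ absorbs it.
  have hm' : |m| ≤ ‖toL2 (w - s)‖ := by
    have h1 : (w - s).prim 1 = -m := by
      have : (w - s).prim 1 = w.prim 1 - s.prim 1 :=
        intervalIntegral.integral_sub (w.continuous_ext.intervalIntegrable _ _)
          (s.continuous_ext.intervalIntegrable _ _)
      rw [this, hw, hs, prim_ofCont _ _ (by simp), hm, zero_sub]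
    have h2 := (w - s).abs_prim_le_norm_toL2 (x := 1) (by simp)
    rwa [h1, abs_neg] at h2
  have hd : ‖toL2 (w - (s - m • c))‖ < ε := by
    rw [dist_eq_norm, ← map_sub] at hψd
    calc ‖toL2 (w - (s - m • c))‖ = ‖toL2 (w - s) + m • toL2 c‖ := by
          rw [← map_smul, ← map_add]; congr 2; abel
      _ ≤ ‖toL2 (w - s)‖ + ‖toL2 (w - s)‖ * ‖toL2 c‖ := by
          refine (norm_add_le _ _).trans ?_
          rw [norm_smul, Real.norm_eq_abs]
          gcongr
      _ = ‖toL2 (w - s)‖ * (1 + ‖toL2 c‖) := by ring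
      _ < ε := (lt_div_iff₀ hB).1 hψd
  rw [dist_eq_norm, he, Prod.mk_sub_mk, ← map_sub, ← map_sub, ← map_sub]
  exact max_lt ((norm_toL2_volterra_le _).trans_lt hd) hd


/-! ### Weak derivatives, integration by parts and duality. -/

/-- A bounded linear relation that holds for the pairs `(φ, φ')` of test functions holds on
their closure. -/
theorem inner_add_inner_eq_zero {a b : L2I} (h : ∀ p ∈ testPairs, inner ℝ a p.1 + inner ℝ b p.2 = 0)
    {p : L2I × L2I} (hp : p ∈ (Submodule.span ℝ testPairs).topologicalClosure) :
    inner ℝ a p.1 + inner ℝ b p.2 = 0 := by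
  let ℓ : L2I × L2I →L[ℝ] ℝ := (innerSL ℝ a).coprod (innerSL ℝ b)
  have hle : (Submodule.span ℝ testPairs).topologicalClosure ≤ ℓ.ker :=
    Submodule.topologicalClosure_minimal _ (Submodule.span_le.2 fun p hp => h p hp) ℓ.isClosed_ker
  exact hle hp

theorem inner_eq_of_ae {a u : L2I} {φ : ℝ → ℝ} (h : u =ᵐ[volume.restrict (Ioo (0 : ℝ) 1)] φ) :
    inner ℝ a u = ∫ x in Ioo (0 : ℝ) 1, a x * φ x := by
  rw [inner_eq]
  refine integral_congr_ae ?_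
  filter_upwards [h] with x hx
  rw [hx]

/-- In this form the definition is a continuous linear condition on pairs, so it extends from test
functions to H¹₀. -/
theorem isWeakDeriv_iff {a b : L2I} :
    IsWeakDeriv b a ↔ ∀ p ∈ testPairs, inner ℝ a p.1 + inner ℝ b p.2 = 0 := by
  constructor
  · rintro h p ⟨φ, hφ, h1, h2⟩
    rw [inner_eq_of_ae h1, inner_eq_of_ae h2, h φ hφ, add_neg_cancel]
  · intro h φ hφ
    have h1 := toL2_ofCont_ae φ hφ.1.continuous
    have h2 := toL2_ofCont_ae _ hφ.continuous_deriv
    have := h (_, _) ⟨φ, hφ, h1, h2⟩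
    rw [inner_eq_of_ae h1, inner_eq_of_ae h2] at this
    linarith

/-- The classical derivative of a `C¹` function is its weak derivative. -/
theorem isWeakDeriv_toL2 (c : ℝ) (f : CI) :
    IsWeakDeriv (toL2 (c • 1 + volterra f)) (toL2 f) := by
  intro φ hφ
  have h1 : ∫ x in Ioo (0 : ℝ) 1, toL2 (c • 1 + volterra f) x * deriv φ x =
      ∫ x in (0 : ℝ)..1, (c + f.prim x) * deriv φ x := by
    rw [← setIntegral_Ioo_eq]
    refine integral_congr_ae ?_
    filter_upwards [coeFn_toL2 (c • 1 + volterra f), ae_restrict_mem measurableSet_Ioo]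
      with x hx hx'
    rw [hx, ext_add, ext_smul_one, ext_volterra _ (Ioo_subset_Icc_self hx')]
  have h2 : ∫ x in Ioo (0 : ℝ) 1, toL2 f x * φ x = ∫ x in (0 : ℝ)..1, f.ext x * φ x := by
    rw [← setIntegral_Ioo_eq]
    refine integral_congr_ae ?_
    filter_upwards [coeFn_toL2 f] with x hx
    rw [hx]
  rw [h1, h2, intervalIntegral.integral_mul_deriv_eq_deriv_mul
    (fun x _ => (f.hasDerivAt_prim x).const_add c) (fun x _ => hφ.hasDerivAt x)
    (f.continuous_ext.intervalIntegrable _ _) (hφ.continuous_deriv.intervalIntegrable _ _),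
    hφ.eq_zero (by simp), hφ.eq_zero (by simp)]
  simp

/-- Integration by parts against `C¹` functions, for `g ∈ H¹₀` with weak derivative `h`. -/
theorem inner_volterra_of_mem_closure {g h : L2I}
    (hp : (g, h) ∈ (Submodule.span ℝ testPairs).topologicalClosure) (c : ℝ) (f : CI) :
    inner ℝ (toL2 f) g + inner ℝ (toL2 (c • 1 + volterra f)) h = 0 :=
  inner_add_inner_eq_zero (isWeakDeriv_iff.1 (isWeakDeriv_toL2 c f)) hp

/-- Membership in `H10I` only provides some limit h of the φ'; this identifies it with the weak
derivative supplied by `H2I`. -/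
theorem isWeakDeriv_of_mem_closure {g h : L2I}
    (hp : (g, h) ∈ (Submodule.span ℝ testPairs).topologicalClosure) : IsWeakDeriv g h := by
  intro φ hφ
  have h1 := inner_volterra_of_mem_closure hp 0 (ofCont _ hφ.continuous_deriv)
  have h2 : (0 : ℝ) • 1 + volterra (ofCont _ hφ.continuous_deriv) = ofCont φ hφ.1.continuous := by
    rw [zero_smul, zero_add]
    ext x
    refine (prim_ofCont _ _ x.2).trans ?_
    rw [intervalIntegral.integral_eq_sub_of_hasDerivAt (fun t _ => hφ.hasDerivAt t)
      (hφ.continuous_deriv.intervalIntegrable _ _), hφ.eq_zero (x := 0) (by simp), sub_zero]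
    rfl
  rw [h2, real_inner_comm, inner_toL2_right, real_inner_comm, inner_toL2_right,
    setIntegral_mul_ext_ofCont, setIntegral_mul_ext_ofCont] at h1
  linarith

theorem solFun_one_eq_prim (q : CI) : q.solFun 1 = (dsol q).prim 1 := rfl

/-- A weak solution of `g'' = q g` in `H² ∩ H¹₀` vanishes unless `y(1) = 0`. -/
theorem eq_zero_of_weak_solution {q : CI} (hq : q.solFun 1 ≠ 0) {g h k : L2I}
    (hp : (g, h) ∈ (Submodule.span ℝ testPairs).topologicalClosure) (hk : IsWeakDeriv h k)
    (he : ∀ f : CI, inner ℝ k (toL2 f) = inner ℝ g (toL2 (q * f))) : g = 0 := by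
  have hL2 : ∀ f : CI, inner ℝ g (toL2 f) = 0 := by
    intro f
    -- This u solves u'' = f + q u with zero initial data. Adding c times the shooting solution,
    -- with c chosen using y(1) ≠ 0, gives v with v(0) = v(1) = 0 and v' = w.
    set u := resolvent q (volterra (volterra f)) with hu
    have hu' : u = volterra (volterra (f + q * u)) := by
      have := resolvent_eq q (volterra (volterra f))
      rw [← hu, potentialOp_apply] at this
      rw [map_add, map_add]; exact this
    set c : ℝ := -(volterra (f + q * u)).prim 1 / q.solFun 1 with hc
    set w : CI := volterra (f + q * u) + c • dsol q with hw
    have hv : volterra w = u + c • sol q := by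
      rw [hw, map_add, map_smul, ← sol_eq, ← hu']
    have hw' : w = c • 1 + volterra (f + q * volterra w) := by
      rw [hv, hw, dsol]
      simp only [mul_add, map_add, smul_add, mul_smul_comm, map_smul]
      abel
    have hw1 : w.prim 1 = 0 := by
      have : w.prim 1 = (volterra (f + q * u)).prim 1 + c * (dsol q).prim 1 := by
        simp only [← eval_volterra_one, hw, map_add, map_smul, smul_eq_mul]
      rw [this, ← solFun_one_eq_prim, hc]
      field_simp
      ring
    -- Two integrations by parts: ⟨f + qv, g⟩ = −⟨w, h⟩ because g is in H¹₀, and ⟨k, v⟩ = −⟨h, w⟩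
    -- because v vanishes at both ends. With ⟨k, v⟩ = ⟨g, qv⟩ this leaves ⟨f, g⟩ = 0.
    have h1 := inner_volterra_of_mem_closure hp c (f + q * volterra w)
    rw [← hw'] at h1
    have h2 := inner_add_inner_eq_zero (isWeakDeriv_iff.1 hk) (mem_closure_testPairs hw1)
    rw [he] at h2
    simp only [map_add, inner_add_left] at h1
    rw [real_inner_comm, real_inner_comm (toL2 w) h] at h2
    rw [real_inner_comm]
    linarith
  refine L2I.eq_zero_of_forall_test fun φ hφ => ?_
  rw [← setIntegral_mul_ext_ofCont _ _ hφ.1.continuous, ← inner_toL2_right]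
  exact hL2 _

/-! ### Eigenvalues of the operator as zeros of y(1). -/

theorem mulPhi1Sq_ae (g : L2I) :
    mulPhi1Sq g =ᵐ[volume.restrict (Ioo (0 : ℝ) 1)] fun x => phi1 x ^ 2 * g x :=
  (memLp_phi1_sq_mul g).coeFn_toLp

/-- The eigenvalue equation as an equation for the second weak derivative. -/
theorem opA_eq_smul_iff (κ μ : ℝ) (g : (opA κ).domain) {h k : L2I}
    (h1 : IsWeakDeriv (g : L2I) h) (h2 : IsWeakDeriv h k) :
    opA κ g = μ • (g : L2I) ↔
      k =ᵐ[volume.restrict (Ioo (0 : ℝ) 1)] fun x => (pot κ μ).ext x * (g : L2I) x := by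
  have hA : opA κ g = -k - (Real.pi ^ 2) • (g : L2I) + (2 * κ) • mulPhi1Sq (g : L2I) := by
    rw [← secondDeriv_eq ⟨g, g.2.1⟩ h1 h2]
    rfl
  have h3 : opA κ g = μ • (g : L2I) ↔
      k = (2 * κ) • mulPhi1Sq (g : L2I) - (Real.pi ^ 2 + μ) • (g : L2I) := by
    rw [hA, add_smul]
    constructor <;> intro h
    · rw [← h]; abel
    · rw [h]; abel
  rw [h3, Lp.ext_iff]
  have h4 : ((2 * κ) • mulPhi1Sq (g : L2I) - (Real.pi ^ 2 + μ) • (g : L2I) : L2I)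
      =ᵐ[volume.restrict (Ioo (0 : ℝ) 1)] fun x => (pot κ μ).ext x * (g : L2I) x := by
    filter_upwards [Lp.coeFn_sub ((2 * κ) • mulPhi1Sq (g : L2I)) ((Real.pi ^ 2 + μ) • (g : L2I)),
      Lp.coeFn_smul (2 * κ) (mulPhi1Sq (g : L2I)), Lp.coeFn_smul (Real.pi ^ 2 + μ) (g : L2I),
      mulPhi1Sq_ae (g : L2I), ae_restrict_mem measurableSet_Ioo] with x e1 e2 e3 e4 hx
    rw [e1, Pi.sub_apply, e2, e3, Pi.smul_apply, Pi.smul_apply, e4,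
      ext_pot _ _ (Ioo_subset_Icc_self hx), smul_eq_mul, smul_eq_mul]
    ring
  exact ⟨fun h => h.trans h4, fun h => h.trans h4.symm⟩

theorem isEigenvalue_of_solFun_eq_zero {κ μ : ℝ} (h : (pot κ μ).solFun 1 = 0) :
    IsEigenvalue (opA κ) μ := by
  set q := pot κ μ
  have h1 : IsWeakDeriv (toL2 (sol q)) (toL2 (dsol q)) := by
    have := isWeakDeriv_toL2 0 (dsol q)
    rwa [zero_smul, zero_add, ← sol_eq] at this
  have h2 : IsWeakDeriv (toL2 (dsol q)) (toL2 (q * sol q)) := by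
    have := isWeakDeriv_toL2 1 (q * sol q)
    rwa [one_smul] at this
  have h3 := mem_closure_testPairs (w := dsol q) h
  rw [← sol_eq] at h3
  refine ⟨⟨toL2 (sol q), ⟨_, _, h1, h2⟩, ⟨_, h3, rfl⟩⟩, ?_, ?_⟩
  · intro h0
    have hpos := integral_sol_sq_pos q
    rw [← norm_toL2_sq] at hpos
    simp only at h0
    rw [h0] at hpos
    simp at hpos
  · rw [opA_eq_smul_iff κ μ _ h1 h2]
    filter_upwards [coeFn_toL2 (sol q), coeFn_toL2 (q * sol q)] with x e1 e2
    rw [e1, e2, ext_mul]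

theorem solFun_eq_zero_of_isEigenvalue {κ μ : ℝ} (h : IsEigenvalue (opA κ) μ) :
    (pot κ μ).solFun 1 = 0 := by
  obtain ⟨⟨g, ⟨h, k, h1, h2⟩, ⟨p, hp, rfl⟩⟩, hg, he⟩ := h
  rw [opA_eq_smul_iff κ μ _ h1 h2] at he
  have hw := isWeakDeriv_of_mem_closure hp
  obtain rfl := hw.unique h1
  by_contra hq
  refine hg (eq_zero_of_weak_solution hq hp h2 fun f => ?_)
  rw [inner_toL2_right, inner_toL2_right]
  refine integral_congr_ae ?_
  filter_upwards [he] with x hx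
  rw [hx, ext_mul]
  simp only [LinearMap.fst_apply]
  ring

theorem isEigenvalue_iff (κ μ : ℝ) : IsEigenvalue (opA κ) μ ↔ (pot κ μ).solFun 1 = 0 :=
  ⟨solFun_eq_zero_of_isEigenvalue, isEigenvalue_of_solFun_eq_zero⟩

end CI
end

theorem lemma1p4 :
    ∃ lam : ℕ+ → ℝ → ℝ,
      (∀ κ : ℝ, StrictMono (fun k : ℕ+ => lam k κ) ∧
        Set.range (fun k : ℕ+ => lam k κ) = {μ : ℝ | IsEigenvalue (opA κ) μ}) ∧
      (∀ k : ℕ+, AnalyticOnNhd ℝ (lam k) Set.univ ∧ StrictMono (lam k)) ∧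
      ∃ K : Set ℝ, K.Countable ∧ K ⊆ Set.Iic 0 ∧
        ∀ κ : ℝ, κ ∉ K → ∀ k : ℕ+, lam k κ ≠ 0 := by
  refine ⟨CI.eig, fun κ => ⟨CI.strictMono_eig_index κ, ?_⟩,
    fun k => ⟨fun κ _ => CI.analyticAt_eig k κ, CI.strictMono_eig k⟩,
    ⋃ k, {κ | CI.eig k κ = 0}, ?_, ?_, ?_⟩
  · simp only [CI.range_eig, CI.isEigenvalue_iff]
  -- Each curve is injective in κ, so it contributes at most one point.
  · refine countable_iUnion fun k => Subsingleton.countable fun κ h κ' h' => ?_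
    exact (CI.strictMono_eig k).injective (Eq.trans h (Eq.symm h'))
  · refine iUnion_subset fun k κ h => ?_
    rw [mem_Iic, ← (CI.strictMono_eig k).le_iff_le]
    exact (Eq.le h).trans (CI.eig_zero_nonneg k)
  · intro κ h k h0
    exact h (mem_iUnion.2 ⟨k, h0⟩)
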